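/- Consider the N-system with $n_1\ge 1$ servers of type $s_1$, each with service rate $\mu_1>0$, and $n_2\ge 0$ servers of type $s_2$, each with service rate $\mu_2>0$; put $n=n_1+n_2$. Customers of types $c_1$ and $c_2$ arrive in independent Poisson streams of rates $\lambda_1,\lambda_2>0$; put $\lambda=\lambda_1+\lambda_2$. Servers of type $s_1$ can serve both customer types, servers of type $s_2$ can serve only type $c_1$. Service times are independent and exponential, with the rate of the server. The policy is FCFS-ALIS: a server who completes a service takes the longest waiting compatible customer (and becomes idle if there is none), and an arriving customer is assigned to the longest idle compatible server (and waits if there is none). Assume $$\frac{\lambda}{n_1\mu_1+n_2\mu_2}<1,\qquad \frac{\lambda_2}{n_1\mu_1}<1 .$$ The state of the system is $\mathfrak s=(S_1,q_1,S_2,q_2,\ldots,S_{n-i},q_{n-i},S_{n-i+1},\ldots,S_n)$. Here $i$ is the number of idle servers and $S_1,\ldots,S_n$ is a permutation of the servers: $S_1,\ldots,S_{n-i}$ are the busy servers, ordered by the arrival times of the customers they are serving (oldest first), and $S_{n-i+1},\ldots,S_n$ are the idle servers in order of increasing idle time. For $j<n-i$, $q_j$ is the number of waiting customers who arrived after the customer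 in service at $S_j$ and before the customer in service at $S_{j+1}$, and $q_{n-i}$ is the number of waiting customers who arrived after the customer in service at $S_{n-i}$. Let $i_1,i_2$ be the numbers of idle servers of types $s_1,s_2$, let $k$ be the number of servers of type $s_2$ that follow the last server of type $s_1$ in $S_1,\ldots,S_n$, and let $\mu(S_j)$ be the service rate of $S_j$. Call $\mathfrak s$ admissible if $q_j=0$ for all $j\le n-i$ with $j<n-k$. Then the Markov chain whose configuration consists of $\mathfrak s$ together with the types of the waiting customers has a unique stationary distribution. Every configuration has exactly one state $\mathfrak s$, and under the stationary distribution the state has law $\pi$, where $\pi(\mathfrak s)=0$ if $\mathfrak s$ is not admissible, and for admissible $\mathfrak s$ $$ \pi(\mathfrak s)=\begin{cases} \displaystyle B\prod_{l=1}^{n-i_1-i_2}\Big(\sum_{j=1}^{l}\mu(S_j)\Big)^{-1}\Big(\frac1\lambda\Big)^{i_1+i_2-k}\Big(\frac1{\lambda_1}\Big)^{k}, & i_1\ge 1,\\[3ex] \displaystyle B\prod_{l=1}^{n-k-1}\Big(\sum_{j=1}^{l}\mu(S_j)\Big)^{-1}\prod_{j=n-k}^{n-i_2}\frac{\lambda_2^{q_j}}{(\mu_1n_1+\mu_2(j-n_1))^{q_j+1}}\Big(\frac1{\lambda_1}\Big)^{i_2},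 & i_1=0,\ i_2\ge 1,\\[3ex] \displaystyle B\prod_{l=1}^{n-k-1}\Big(\sum_{j=1}^{l}\mu(S_j)\Big)^{-1}\prod_{j=n-k}^{n-1}\frac{\lambda_2^{q_j}}{(\mu_1n_1+\mu_2(j-n_1))^{q_j+1}}\cdot\frac{\lambda^{q_n}}{(\mu_1n_1+\mu_2n_2)^{q_n+1}}, & i_1=i_2=0, \end{cases} $$ with a normalizing constant $B>0$ for which $\sum_{\mathfrak s}\pi(\mathfrak s)=1$. -/

import Mathlib

namespace NSystem

/-- The two customer types. -/
inductive Customer : Type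
  | c1
  | c2
  deriving DecidableEq

/-- The servers: `Sum.inl a` are the `n₁` flexible servers (type `s₁`), `Sum.inr b` are the
`n₂` servers of type `s₂`. -/
abbrev Server (n₁ n₂ : ℕ) : Type := Fin n₁ ⊕ Fin n₂

/-- Compatibility: servers of type `s₁` serve both types, servers of type `s₂` only `c₁`. -/
def canServe {n₁ n₂ : ℕ} : Server n₁ n₂ → Customer → Bool
  | Sum.inl _, _ => true
  | Sum.inr _, Customer.c1 => true
  | Sum.inr _, Customer.c2 => false

/-- The service rate of a server. -/
def serviceRate {n₁ n₂ : ℕ} (μ₁ μ₂ : ℝ) : Server n₁ n₂ → ℝ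
  | Sum.inl _ => μ₁
  | Sum.inr _ => μ₂

/-- A configuration of the system, with the types of all waiting customers.
`line` lists all customers present in order of arrival (oldest first): `Sum.inl v` is a customer
in service with server `v`, `Sum.inr c` is a waiting customer of type `c`.
`idle` lists the idle servers by increasing idle time (the longest idle server comes last). -/
structure Config (n₁ n₂ : ℕ) : Type where
  line : List (Server n₁ n₂ ⊕ Customer)
  idle : List (Server n₁ n₂)

namespace Config

variable {n₁ n₂ : ℕ}

/-- The customers in order of arrival, followed by the idle servers. -/
def items (x : Config n₁ n₂) : List (Server n₁ n₂ ⊕ Customer) :=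
  x.line ++ x.idle.map Sum.inl

/-- The possible configurations under FCFS-ALIS: every server occurs exactly once (busy or idle),
and a waiting customer is incompatible with every idle server and with every server that is
busy with a customer who arrived later. -/
structure IsFeasible (x : Config n₁ n₂) : Prop where
  servers : ∀ v : Server n₁ n₂, x.items.count (Sum.inl v) = 1
  skipped : x.items.Pairwise
    (fun a b => ∀ c v, a = Sum.inr c → b = Sum.inl v → canServe v c = false)

/-- Arrival of a customer of type `c`: he is assigned to the longest idle compatible server, and
he waits if there is none. -/
def arrive (c : Customer) (x : Config n₁ n₂) : Config n₁ n₂ :=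
  match x.idle.reverse.find? (fun v => canServe v c) with
  | some v => ⟨x.line ++ [Sum.inl v], x.idle.erase v⟩
  | none => ⟨x.line ++ [Sum.inr c], x.idle⟩

/-- Is this item of the line a waiting customer whom server `v` can serve? -/
def isWaitingFor (v : Server n₁ n₂) : Server n₁ n₂ ⊕ Customer → Bool
  | Sum.inl _ => false
  | Sum.inr c => canServe v c

/-- Service completion at the busy server `v`: his customer leaves, and `v` takes the longest
waiting compatible customer; if there is none, `v` becomes the most recently idle server. -/
def complete (v : Server n₁ n₂) (x : Config n₁ n₂) : Config n₁ n₂ :=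
  match (x.line.erase (Sum.inl v)).findIdx? (isWaitingFor v) with
  | some m => ⟨(x.line.erase (Sum.inl v)).set m (Sum.inl v), x.idle⟩
  | none => ⟨x.line.erase (Sum.inl v), v :: x.idle⟩

open Classical in
/-- The transition rate from `x` to `y`: Poisson arrivals with rates `lam₁`, `lam₂` and
exponential services with rate `μ₁` or `μ₂` according to the type of the server. -/
noncomputable def rate (lam₁ lam₂ μ₁ μ₂ : ℝ) (x y : Config n₁ n₂) : ℝ :=
  (if x.arrive Customer.c1 = y then lam₁ else 0)
    + (if x.arrive Customer.c2 = y then lam₂ else 0)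
    + ∑ v : Server n₁ n₂,
        if Sum.inl v ∈ x.line ∧ x.complete v = y then serviceRate μ₁ μ₂ v else 0

end Config

/-- The state space of the N-system as a continuous time Markov chain. -/
abbrev Feasible (n₁ n₂ : ℕ) : Type := {x : Config n₁ n₂ // x.IsFeasible}

/-- The transition rates of the N-system. -/
noncomputable def rate {n₁ n₂ : ℕ} (lam₁ lam₂ μ₁ μ₂ : ℝ) (x y : Feasible n₁ n₂) : ℝ :=
  Config.rate lam₁ lam₂ μ₁ μ₂ x.1 y.1

/-- `p` is a stationary distribution of the continuous time Markov chain on `S` with (bounded)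
transition rates `q x y` from `x` to `y`: a probability distribution that satisfies the global
balance equations (probability flow into `x` = probability flow out of `x`). -/
structure IsStationaryDistribution {S : Type*} (q : S → S → ℝ) (p : S → ℝ) : Prop where
  nonneg : ∀ x, 0 ≤ p x
  hasSum_one : HasSum p 1
  balance : ∀ x, HasSum (fun y => p y * q y x) (p x * ∑' y, q x y)

/-- The state `(S_1, q_1, …, S_{n-i}, q_{n-i}, S_{n-i+1}, …, S_n)`: a permutation of the servers
(`perm j` is `S_{j+1}`), the number `i` of idle servers and the queue lengths
(`q j` is `q_{j+1}`). -/
structure State (n₁ n₂ : ℕ) : Type where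
  perm : Fin (n₁ + n₂) ≃ Server n₁ n₂
  i : ℕ
  i_le : i ≤ n₁ + n₂
  q : Fin (n₁ + n₂ - i) → ℕ

namespace State

variable {n₁ n₂ : ℕ}

/-- The `j`-th busy server `S_{j+1}`. -/
def busyServer (s : State n₁ n₂) (j : Fin (n₁ + n₂ - s.i)) : Server n₁ n₂ :=
  s.perm (Fin.castLE (Nat.sub_le _ _) j)

/-- `s` is the state of the configuration `x`: apart from the types of the waiting customers,
the line of `x` reads `S_1`, then `q_1` waiting customers, then `S_2`, then `q_2` waiting
customers, …, `S_{n-i}`, then `q_{n-i}` waiting customers, and the idle servers of `x` are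
`S_{n-i+1}, …, S_n`. -/
def IsStateOf (s : State n₁ n₂) (x : Config n₁ n₂) : Prop :=
  x.line.map (Sum.map id (fun _ => ())) =
      (List.ofFn (fun j : Fin (n₁ + n₂ - s.i) =>
        Sum.inl (s.busyServer j) :: List.replicate (s.q j) (Sum.inr ()))).flatten
    ∧ x.idle = (List.ofFn s.perm).drop (n₁ + n₂ - s.i)

/-- The queue length `q_j`, for `1 ≤ j ≤ n - i`. -/
def queue (s : State n₁ n₂) (j : ℕ) : ℕ :=
  if h : j - 1 < n₁ + n₂ - s.i then s.q ⟨j - 1, h⟩ else 0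

/-- `I₁`, the number of idle servers of type `s₁`. -/
def I₁ (s : State n₁ n₂) : ℕ :=
  (Finset.univ.filter
    (fun j : Fin (n₁ + n₂) => n₁ + n₂ - s.i ≤ j.val ∧ (s.perm j).isLeft = true)).card

/-- `I₂`, the number of idle servers of type `s₂`. -/
def I₂ (s : State n₁ n₂) : ℕ :=
  (Finset.univ.filter
    (fun j : Fin (n₁ + n₂) => n₁ + n₂ - s.i ≤ j.val ∧ (s.perm j).isRight = true)).card

/-- `K`, the number of servers of type `s₂` that follow the last server of type `s₁` in
`S_1, …, S_n`. -/
def K (s : State n₁ n₂) : ℕ :=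
  (Finset.univ.filter
    (fun j : Fin (n₁ + n₂) => ∀ j' : Fin (n₁ + n₂), j ≤ j' → (s.perm j').isRight = true)).card

/-- No customer waits for a server that precedes the last server of type `s₁`:
`q_j = 0` for all `j < n - k`, `j ≤ n - i`. -/
def IsAdmissible (s : State n₁ n₂) : Prop :=
  ∀ j : ℕ, 1 ≤ j → j < n₁ + n₂ - s.K → j ≤ n₁ + n₂ - s.i → s.queue j = 0

/-- The partial sum `μ(S_1) + ⋯ + μ(S_l)`. -/
noncomputable def partialRate (μ₁ μ₂ : ℝ) (s : State n₁ n₂) (l : ℕ) : ℝ :=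
  ∑ j : Fin (n₁ + n₂) with j.val < l, serviceRate μ₁ μ₂ (s.perm j)

/-- The three-case product form, without the normalizing constant. -/
noncomputable def weight (lam₁ lam₂ μ₁ μ₂ : ℝ) (s : State n₁ n₂) : ℝ :=
  if 0 < s.I₁ then
    (∏ l ∈ Finset.Icc 1 (n₁ + n₂ - s.I₁ - s.I₂), (s.partialRate μ₁ μ₂ l)⁻¹)
      * (1 / (lam₁ + lam₂)) ^ (s.I₁ + s.I₂ - s.K) * (1 / lam₁) ^ s.K
  else if 0 < s.I₂ then
    (∏ l ∈ Finset.Icc 1 (n₁ + n₂ - s.K - 1), (s.partialRate μ₁ μ₂ l)⁻¹)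
      * (∏ j ∈ Finset.Icc (n₁ + n₂ - s.K) (n₁ + n₂ - s.I₂),
          lam₂ ^ s.queue j / (μ₁ * n₁ + μ₂ * ((j : ℝ) - n₁)) ^ (s.queue j + 1))
      * (1 / lam₁) ^ s.I₂
  else
    (∏ l ∈ Finset.Icc 1 (n₁ + n₂ - s.K - 1), (s.partialRate μ₁ μ₂ l)⁻¹)
      * (∏ j ∈ Finset.Icc (n₁ + n₂ - s.K) (n₁ + n₂ - 1),
          lam₂ ^ s.queue j / (μ₁ * n₁ + μ₂ * ((j : ℝ) - n₁)) ^ (s.queue j + 1))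
      * ((lam₁ + lam₂) ^ s.queue (n₁ + n₂)
          / (μ₁ * n₁ + μ₂ * n₂) ^ (s.queue (n₁ + n₂) + 1))

open Classical in
/-- The product form with normalizing constant `B`; it vanishes at tuples that are not
admissible. -/
noncomputable def productForm (lam₁ lam₂ μ₁ μ₂ B : ℝ) (s : State n₁ n₂) : ℝ :=
  if s.IsAdmissible then B * s.weight lam₁ lam₂ μ₁ μ₂ else 0

end State

end NSystem

namespace NSystem

/-! Give every configuration, customer types included, a product weight `Config.weight`. A busy
server contributes the reciprocal of the total rate of the busy servers up to and including itself.
A waiting customer of type `c` contributes `lam c` divided by the total rate of the busy servers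
ahead of him. An idle server contributes the reciprocal of the arrival rate of the types that it or
some longer idle server can serve.

Global balance splits into two partial balances: inflow by arrivals equals outflow by completions
(`Config.hasSum_arrive`), and inflow by completions equals outflow by arrivals
(`Config.hasSum_complete`). Undoing a move puts one server back at an arbitrary place of the idle
list or of a part of the line. The sums over these places are evaluated by
`sum_idleWeight_insertIdx` and `sum_lineWeight_insertIdx`, and the contributions of the busy servers
telescope.

Uniqueness is `IsStationaryDistribution.eq`: if `f` is the difference of two stationary
distributions, then `|f|` also solves the balance equations, and since one state is reached from all
others, `f` has constant sign; its sum is 0.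

For the law of the state, the types of the waiting customers are summed out. Each type is restricted
only by the servers behind that customer, idle ones included, so the sum factorizes
(`sum_labelings`, `State.totalWeight_eq`). In the N-system each waiting customer contributes the
rate 0, `lam₂` or `lam₁ + lam₂`, according as a server of type `s₁`, only servers of type `s₂`, or
no servers at all come behind him. This gives admissibility and the three cases. The two load
conditions bound the weights by products of geometric terms, so the total weight is finite. -/

instance : Fintype Customer := ⟨{Customer.c1, Customer.c2}, fun c => by cases c <;> simp⟩

theorem Customer.sum_univ (f : Customer → ℝ) : ∑ c, f c = f Customer.c1 + f Customer.c2 := by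
  change ∑ c ∈ ({Customer.c1, Customer.c2} : Finset Customer), f c = _
  simp

/-! ### Product weights and their insertion identities. -/

/-- The items of a line: busy servers and waiting customers. -/
abbrev Item (n₁ n₂ : ℕ) : Type := Server n₁ n₂ ⊕ Customer

variable {n₁ n₂ : ℕ}

/-- The total arrival rate of the customers that some server in `l` can serve. -/
noncomputable def servedRate (lam : Customer → ℝ) (l : List (Server n₁ n₂)) : ℝ :=
  ∑ c, if ∃ v ∈ l, canServe v c = true then lam c else 0

/-- The weight of a list of idle servers. -/
noncomputable def idleWeight (lam : Customer → ℝ) : List (Server n₁ n₂) → ℝ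
  | [] => 1
  | v :: l => (servedRate lam (v :: l))⁻¹ * idleWeight lam l

/-- The weight of a line that follows busy servers of total rate `m`. -/
noncomputable def lineWeight (lam : Customer → ℝ) (mu : Server n₁ n₂ → ℝ) :
    ℝ → List (Item n₁ n₂) → ℝ
  | _, [] => 1
  | m, Sum.inl v :: L => (m + mu v)⁻¹ * lineWeight lam mu (m + mu v) L
  | m, Sum.inr c :: L => lam c / m * lineWeight lam mu m L

/-- The total rate of the busy servers in a line. -/
noncomputable def busyRate (mu : Server n₁ n₂ → ℝ) : List (Item n₁ n₂) → ℝ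
  | [] => 0
  | Sum.inl v :: L => mu v + busyRate mu L
  | Sum.inr _ :: L => busyRate mu L

/-- The weight of a configuration in the stationary distribution. -/
noncomputable def Config.weight (lam : Customer → ℝ) (mu : Server n₁ n₂ → ℝ)
    (x : Config n₁ n₂) : ℝ :=
  lineWeight lam mu 0 x.line * idleWeight lam x.idle

theorem canServe_c1 (v : Server n₁ n₂) : canServe v Customer.c1 = true := by
  cases v <;> rfl

theorem canServe_inl (a : Fin n₁) (c : Customer) :
    canServe (Sum.inl a : Server n₁ n₂) c = true := rfl

section Weights

variable {lam : Customer → ℝ} {mu : Server n₁ n₂ → ℝ}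

theorem servedRate_nil : servedRate lam ([] : List (Server n₁ n₂)) = 0 := by
  simp [servedRate]

theorem servedRate_congr {l l' : List (Server n₁ n₂)} (h : ∀ v, v ∈ l ↔ v ∈ l') :
    servedRate lam l = servedRate lam l' :=
  Finset.sum_congr rfl fun c _ => if_congr (by simp only [h]) rfl rfl

theorem servedRate_cons_pos (hlam : ∀ c, 0 < lam c) (v : Server n₁ n₂)
    (l : List (Server n₁ n₂)) : 0 < servedRate lam (v :: l) := by
  refine Finset.sum_pos' (fun c _ => ?_) ⟨Customer.c1, Finset.mem_univ _, ?_⟩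
  · split_ifs
    exacts [(hlam c).le, le_rfl]
  · rw [if_pos ⟨v, by simp, canServe_c1 v⟩]
    exact hlam _

/-- If `l` lists the servers idle for longer than `v`, this is the rate of the arrivals assigned to
`v`. For completions it is the total rate of the types that `v` serves and no server of `l` does. -/
theorem servedRate_cons_sub (v : Server n₁ n₂) (l : List (Server n₁ n₂)) :
    servedRate lam (v :: l) - servedRate lam l =
      ∑ c, if canServe v c = true ∧ ∀ u ∈ l, canServe u c = false then lam c else 0 := by
  rw [servedRate, servedRate, ← Finset.sum_sub_distrib]
  refine Finset.sum_congr rfl fun c _ => ?_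
  by_cases h1 : ∃ u ∈ l, canServe u c = true
  · have h2 : ¬ ∀ u ∈ l, canServe u c = false := by
      obtain ⟨u, hu, hc⟩ := h1
      intro h
      simp [h u hu] at hc
    have h3 : ∃ u ∈ v :: l, canServe u c = true := by
      obtain ⟨u, hu, hc⟩ := h1
      exact ⟨u, by simp [hu], hc⟩
    simp only [h1, h2, h3, if_true, and_false, if_false, sub_self]
  · have h2 : ∀ u ∈ l, canServe u c = false := by
      intro u hu
      by_contra h
      exact h1 ⟨u, hu, by simpa using h⟩
    have h3 : (∃ u ∈ v :: l, canServe u c = true) ↔ canServe v c = true := by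
      constructor
      · rintro ⟨u, hu, hc⟩
        rcases List.mem_cons.1 hu with rfl | hu
        · exact hc
        · exact absurd ⟨u, hu, hc⟩ h1
      · intro h
        exact ⟨v, by simp, h⟩
    simp only [h3, if_neg h1, sub_zero]
    exact if_congr ⟨fun h => ⟨h, h2⟩, fun h => h.1⟩ rfl rfl

theorem idleWeight_pos (hlam : ∀ c, 0 < lam c) (l : List (Server n₁ n₂)) :
    0 < idleWeight lam l := by
  induction l with
  | nil => simp [idleWeight]
  | cons v l ih => exact mul_pos (inv_pos.2 (servedRate_cons_pos hlam v l)) ih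

/-- Inserting `v` behind the head does not alter the set of servers from the head on up to adding
`v`, so the head factor is the same for all such places and the induction hypothesis sums them. The
place `k = 0` supplies the missing part. -/
theorem sum_idleWeight_insertIdx (hlam : ∀ c, 0 < lam c) (v : Server n₁ n₂)
    (l : List (Server n₁ n₂)) :
    ∑ k ∈ Finset.range (l.length + 1), idleWeight lam (l.insertIdx k v) *
      (servedRate lam (v :: l.drop k) - servedRate lam (l.drop k)) = idleWeight lam l := by
  induction l with
  | nil =>
    have := servedRate_cons_pos hlam v []
    simp [idleWeight, servedRate_nil]
    field_simp
  | cons a l ih =>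
    rw [List.length_cons, Finset.sum_range_succ']
    simp only [List.insertIdx_succ_cons, List.drop_succ_cons, List.insertIdx_zero,
      List.drop_zero, idleWeight]
    have h1 : ∀ k ∈ Finset.range (l.length + 1),
        (servedRate lam (a :: l.insertIdx k v))⁻¹ * idleWeight lam (l.insertIdx k v) *
          (servedRate lam (v :: l.drop k) - servedRate lam (l.drop k)) =
        (servedRate lam (v :: a :: l))⁻¹ * (idleWeight lam (l.insertIdx k v) *
          (servedRate lam (v :: l.drop k) - servedRate lam (l.drop k))) := by
      intro k hk
      have hk' : k ≤ l.length := by simpa [Nat.lt_succ_iff] using hk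
      rw [servedRate_congr (l' := v :: a :: l), mul_assoc]
      intro u
      simp only [List.mem_cons, List.mem_insertIdx hk']
      tauto
    rw [Finset.sum_congr rfl h1, ← Finset.mul_sum, ih]
    have h2 := servedRate_cons_pos hlam v (a :: l)
    have h3 := servedRate_cons_pos hlam a l
    field_simp
    ring

theorem busyRate_append (A B : List (Item n₁ n₂)) :
    busyRate mu (A ++ B) = busyRate mu A + busyRate mu B := by
  induction A with
  | nil => simp [busyRate]
  | cons a A ih => cases a <;> simp [busyRate, ih, add_assoc]

theorem lineWeight_append (m : ℝ) (A B : List (Item n₁ n₂)) :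
    lineWeight lam mu m (A ++ B) =
      lineWeight lam mu m A * lineWeight lam mu (m + busyRate mu A) B := by
  induction A generalizing m with
  | nil => simp [lineWeight, busyRate]
  | cons a A ih => cases a <;> simp [busyRate, lineWeight, ih, ← add_assoc, mul_assoc]

theorem lineWeight_nonneg (hlam : ∀ c, 0 < lam c) (hmu : ∀ v, 0 < mu v) {m : ℝ} (hm : 0 ≤ m)
    (L : List (Item n₁ n₂)) : 0 ≤ lineWeight lam mu m L := by
  induction L generalizing m with
  | nil => simp [lineWeight]
  | cons a L ih =>
    cases a with
    | inl v =>
      have := hmu v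
      exact mul_nonneg (by positivity) (ih (by positivity))
    | inr c =>
      have := hlam c
      exact mul_nonneg (by positivity) (ih hm)

/-- The subtracted term accounts for the places of `u` among items ahead of `L`, of total rate `m`;
it makes the induction close and vanishes at `m = 0`. The hypothesis `h` avoids the factor `lam c /
0`. -/
theorem sum_lineWeight_insertIdx_aux (hmu : ∀ v, 0 < mu v)
    (u : Server n₁ n₂) {m : ℝ} (hm : 0 ≤ m) (L : List (Item n₁ n₂))
    (h : m = 0 → ∀ c L', L ≠ Sum.inr c :: L') :
    ∑ k ∈ Finset.range (L.length + 1), mu u * lineWeight lam mu m (L.insertIdx k (Sum.inl u)) =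
      lineWeight lam mu m L - m / (m + mu u) * lineWeight lam mu (m + mu u) L := by
  have hu := hmu u
  induction L generalizing m with
  | nil =>
    simp [lineWeight]
    field_simp
    ring
  | cons a L ih =>
    rw [List.length_cons, Finset.sum_range_succ']
    simp only [List.insertIdx_succ_cons, List.insertIdx_zero]
    cases a with
    | inl v =>
      have hv := hmu v
      simp only [lineWeight]
      rw [Finset.sum_congr rfl fun k _ => mul_left_comm _ _ _, ← Finset.mul_sum,
        ih (m := m + mu v) (by positivity) (fun h0 => by linarith)]
      rw [add_right_comm m (mu v) (mu u)]
      generalize lineWeight lam mu (m + mu u + mu v) L = X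
      generalize lineWeight lam mu (m + mu v) L = Y
      field_simp
      ring
    | inr c =>
      have hm' : 0 < m := lt_of_le_of_ne hm fun h0 => h h0.symm c L rfl
      simp only [lineWeight]
      rw [Finset.sum_congr rfl fun k _ => mul_left_comm _ _ _, ← Finset.mul_sum,
        ih hm (fun h0 => by linarith)]
      generalize lineWeight lam mu (m + mu u) L = X
      generalize lineWeight lam mu m L = Y
      field_simp
      ring

theorem sum_lineWeight_insertIdx (hmu : ∀ v, 0 < mu v) (u : Server n₁ n₂)
    (L : List (Item n₁ n₂)) (h : ∀ c L', L ≠ Sum.inr c :: L') :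
    ∑ k ∈ Finset.range (L.length + 1), mu u * lineWeight lam mu 0 (L.insertIdx k (Sum.inl u)) =
      lineWeight lam mu 0 L := by
  simpa using sum_lineWeight_insertIdx_aux (lam := lam) hmu u le_rfl L fun _ => h

theorem busyRate_insertIdx (u : Server n₁ n₂) (L : List (Item n₁ n₂)) {k : ℕ}
    (hk : k ≤ L.length) : busyRate mu (L.insertIdx k (Sum.inl u)) = busyRate mu L + mu u := by
  induction L generalizing k with
  | nil =>
    obtain rfl : k = 0 := by simpa using hk
    simp [busyRate]
  | cons a L ih =>
    cases k with
    | zero => simp [busyRate, add_comm]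
    | succ k =>
      have := ih (k := k) (by simpa using hk)
      cases a <;> simp [busyRate, this, add_assoc]

end Weights

/-! ### Feasible configurations and normal forms of the two moves. -/

instance {α β : Type*} [BEq α] [BEq β] [LawfulBEq α] [LawfulBEq β] : LawfulBEq (α ⊕ β) where
  eq_of_beq {a b} h := by
    cases a <;> cases b
    · exact congrArg _ (eq_of_beq h)
    · exact absurd h Bool.false_ne_true
    · exact absurd h Bool.false_ne_true
    · exact congrArg _ (eq_of_beq h)
  rfl {a} := by
    cases a
    · exact beq_self_eq_true (α := α) _
    · exact beq_self_eq_true (α := β) _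

/-- The order relation between the items of a feasible line. -/
abbrev Skips (a b : Item n₁ n₂) : Prop :=
  ∀ c v, a = Sum.inr c → b = Sum.inl v → canServe v c = false

theorem Skips.inl_left (v : Server n₁ n₂) (b : Item n₁ n₂) : Skips (Sum.inl v) b :=
  fun _ _ h => by simp at h

theorem Skips.inr_right (a : Item n₁ n₂) (c : Customer) : Skips a (Sum.inr c) :=
  fun _ _ _ h => by simp at h

namespace Config

theorem isFeasible_iff (L : List (Item n₁ n₂)) (I : List (Server n₁ n₂)) :
    (⟨L, I⟩ : Config n₁ n₂).IsFeasible ↔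
      (∀ v, L.count (Sum.inl v) + I.count v = 1) ∧ L.Pairwise Skips ∧
        ∀ c, Sum.inr c ∈ L → ∀ v ∈ I, canServe v c = false := by
  have hc : ∀ v : Server n₁ n₂, (I.map (Sum.inl : _ → Item n₁ n₂)).count (Sum.inl v) = I.count v :=
    fun v => List.count_map_of_injective _ _ Sum.inl_injective _
  constructor
  · rintro ⟨h1, h2⟩
    simp only [items, List.count_append, hc] at h1
    rw [items, List.pairwise_append] at h2
    exact ⟨h1, h2.1, fun c hcL v hv => h2.2.2 _ hcL _ (List.mem_map_of_mem hv) c v rfl rfl⟩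
  · rintro ⟨h1, h2, h3⟩
    refine ⟨fun v => by simp only [items, List.count_append, hc, h1], ?_⟩
    rw [items, List.pairwise_append]
    refine ⟨h2, ?_, ?_⟩
    · rw [List.pairwise_map]
      exact List.pairwise_of_forall fun a b => Skips.inl_left _ _
    · rintro a ha b hb c v rfl rfl
      obtain ⟨w, hw, hwv⟩ := List.mem_map.1 hb
      obtain rfl := Sum.inl_injective hwv
      exact h3 c ha w hw

/-- The search runs through the reversed idle list, so `B` consists of the longer idle servers, all
incompatible with `c`; `hA` ensures that `erase` removes the displayed occurrence. -/
theorem arrive_of_served {c : Customer} {v : Server n₁ n₂} {A B : List (Server n₁ n₂)}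
    (L : List (Item n₁ n₂)) (hv : canServe v c = true) (hB : ∀ u ∈ B, canServe u c = false)
    (hA : v ∉ A) :
    arrive c ⟨L, A ++ v :: B⟩ = ⟨L ++ [Sum.inl v], A ++ B⟩ := by
  have : (A ++ v :: B).reverse.find? (fun u => canServe u c) = some v := by
    rw [List.find?_eq_some_iff_append]
    refine ⟨hv, B.reverse, A.reverse, by simp, fun u hu => ?_⟩
    simp [hB u (by simpa using hu)]
  simp only [arrive, this]
  rw [List.erase_append_right _ hA, List.erase_cons_head]

theorem arrive_of_not_served {c : Customer} {I : List (Server n₁ n₂)}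
    (L : List (Item n₁ n₂)) (hI : ∀ u ∈ I, canServe u c = false) :
    arrive c ⟨L, I⟩ = ⟨L ++ [Sum.inr c], I⟩ := by
  have : I.reverse.find? (fun u => canServe u c) = none := by
    rw [List.find?_eq_none]
    intro u hu
    simp [hI u (by simpa using hu)]
  simp only [arrive, this]

theorem served_or_not_served (c : Customer) (I : List (Server n₁ n₂)) :
    (∀ u ∈ I, canServe u c = false) ∨ ∃ A v B, I = A ++ v :: B ∧ canServe v c = true ∧
      ∀ u ∈ B, canServe u c = false := by
  cases h : I.reverse.find? (fun u => canServe u c) with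
  | none =>
    rw [List.find?_eq_none] at h
    exact Or.inl fun u hu => by simpa using h u (by simpa using hu)
  | some v =>
    rw [List.find?_eq_some_iff_append] at h
    obtain ⟨hv, B, A, hI, hB⟩ := h
    refine Or.inr ⟨A.reverse, v, B.reverse, ?_, hv, fun u hu => ?_⟩
    · rw [← List.reverse_reverse I, hI]
      simp
    · simpa using hB u (by simpa using hu)

theorem complete_of_not_waiting {v : Server n₁ n₂} {P R : List (Item n₁ n₂)}
    (I : List (Server n₁ n₂)) (hP : Sum.inl v ∉ P)
    (hw : ∀ z ∈ P ++ R, isWaitingFor v z = false) :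
    complete v ⟨P ++ Sum.inl v :: R, I⟩ = ⟨P ++ R, v :: I⟩ := by
  have h1 : (P ++ Sum.inl v :: R).erase (Sum.inl v) = P ++ R := by
    rw [List.erase_append_right _ hP, List.erase_cons_head]
  have h2 : (P ++ R).findIdx? (isWaitingFor v) = none := by
    rw [List.findIdx?_eq_none_iff]
    exact hw
  simp only [complete, h1, h2]

theorem complete_of_waiting {v : Server n₁ n₂} {c : Customer} {P R₁ R₂ : List (Item n₁ n₂)}
    (I : List (Server n₁ n₂)) (hP : Sum.inl v ∉ P)
    (hw : ∀ z ∈ P ++ R₁, isWaitingFor v z = false) (hc : canServe v c = true) :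
    complete v ⟨P ++ Sum.inl v :: (R₁ ++ Sum.inr c :: R₂), I⟩ =
      ⟨P ++ R₁ ++ Sum.inl v :: R₂, I⟩ := by
  have h1 : (P ++ Sum.inl v :: (R₁ ++ Sum.inr c :: R₂)).erase (Sum.inl v) =
      P ++ R₁ ++ Sum.inr c :: R₂ := by
    rw [List.erase_append_right _ hP, List.erase_cons_head, List.append_assoc]
  have h2 : (P ++ R₁ ++ Sum.inr c :: R₂).findIdx? (isWaitingFor v) = some (P ++ R₁).length := by
    rw [List.findIdx?_append, List.findIdx?_eq_none_iff.2 hw, List.findIdx?_cons]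
    simp [isWaitingFor, hc]
  simp only [complete, h1, h2]
  congr 1
  rw [List.set_append_right _ _ le_rfl]
  simp

/-- Customers ahead of `v` were skipped by it, so at a completion only the items behind `v` can
offer a compatible customer. -/
theorem IsFeasible.not_waiting {v : Server n₁ n₂} {P R : List (Item n₁ n₂)}
    {I : List (Server n₁ n₂)} (h : (⟨P ++ Sum.inl v :: R, I⟩ : Config n₁ n₂).IsFeasible) :
    ∀ z ∈ P, isWaitingFor v z = false := by
  rw [isFeasible_iff, List.pairwise_append] at h
  intro z hz
  cases z with
  | inl u => rfl
  | inr c => exact h.2.1.2.2 _ hz _ (by simp) c v rfl rfl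

theorem IsFeasible.notMem {v : Server n₁ n₂} {P R : List (Item n₁ n₂)}
    {I : List (Server n₁ n₂)} (h : (⟨P ++ Sum.inl v :: R, I⟩ : Config n₁ n₂).IsFeasible) :
    Sum.inl v ∉ P ∧ Sum.inl v ∉ R ∧ v ∉ I := by
  have := ((isFeasible_iff _ _).1 h).1 v
  simp only [List.count_append, List.count_cons_self] at this
  refine ⟨?_, ?_, ?_⟩ <;> refine List.count_eq_zero.1 ?_ <;> omega

theorem IsFeasible.notMem_idle {v : Server n₁ n₂} {L : List (Item n₁ n₂)}
    {A B : List (Server n₁ n₂)} (h : (⟨L, A ++ v :: B⟩ : Config n₁ n₂).IsFeasible) :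
    Sum.inl v ∉ L ∧ v ∉ A ∧ v ∉ B := by
  have := ((isFeasible_iff _ _).1 h).1 v
  simp only [List.count_append, List.count_cons_self] at this
  refine ⟨?_, ?_, ?_⟩ <;> refine List.count_eq_zero.1 ?_ <;> omega

/-- The two ways in which a service can end. -/
theorem IsFeasible.exists_complete {v : Server n₁ n₂} {y : Config n₁ n₂} (h : y.IsFeasible)
    (hv : Sum.inl v ∈ y.line) :
    (∃ P R I, y = ⟨P ++ Sum.inl v :: R, I⟩ ∧ (∀ z ∈ P ++ R, isWaitingFor v z = false)) ∨
    ∃ P R₁ c R₂ I, y = ⟨P ++ Sum.inl v :: (R₁ ++ Sum.inr c :: R₂), I⟩ ∧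
      (∀ z ∈ P ++ R₁, isWaitingFor v z = false) ∧ canServe v c = true := by
  obtain ⟨L, I⟩ := y
  obtain ⟨P, R, rfl⟩ := List.append_of_mem hv
  have hP := h.not_waiting
  cases hR : R.find? (isWaitingFor v) with
  | none =>
    rw [List.find?_eq_none] at hR
    refine Or.inl ⟨P, R, I, rfl, fun z hz => ?_⟩
    rcases List.mem_append.1 hz with hz | hz
    · exact hP z hz
    · simpa using hR z hz
  | some z =>
    rw [List.find?_eq_some_iff_append] at hR
    obtain ⟨hz, R₁, R₂, rfl, hR₁⟩ := hR
    cases z with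
    | inl u => simp [isWaitingFor] at hz
    | inr c =>
      refine Or.inr ⟨P, R₁, c, R₂, I, rfl, fun z hz => ?_, hz⟩
      rcases List.mem_append.1 hz with hz | hz
      · exact hP z hz
      · simpa using hR₁ z hz

theorem IsFeasible.arrive {x : Config n₁ n₂} (h : x.IsFeasible) (c : Customer) :
    (x.arrive c).IsFeasible := by
  obtain ⟨L, I⟩ := x
  rcases served_or_not_served c I with hI | ⟨A, v, B, rfl, hv, hB⟩
  · rw [arrive_of_not_served L hI]
    rw [isFeasible_iff] at h ⊢
    refine ⟨by simpa [List.count_append] using h.1, ?_, ?_⟩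
    · rw [List.pairwise_append]
      exact ⟨h.2.1, by simp, fun a _ b hb => List.mem_singleton.1 hb ▸ Skips.inr_right a c⟩
    · intro d hd u hu
      rcases List.mem_append.1 hd with hd | hd
      · exact h.2.2 d hd u hu
      · obtain rfl : d = c := by simpa using hd
        exact hI u hu
  · rw [arrive_of_served L hv hB h.notMem_idle.2.1]
    rw [isFeasible_iff] at h ⊢
    refine ⟨fun u => ?_, ?_, ?_⟩
    · have := h.1 u
      simp only [List.count_append, List.count_cons, List.count_nil, beq_iff_eq,
        Sum.inl.injEq] at this ⊢
      omega
    · rw [List.pairwise_append]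
      refine ⟨h.2.1, by simp, ?_⟩
      rintro a ha b hb d u rfl rfl
      exact h.2.2 d ha u (by simp_all)
    · intro d hd u hu
      refine h.2.2 d (by simpa using hd) u ?_
      simp only [List.mem_append, List.mem_cons] at hu ⊢
      tauto

theorem IsFeasible.complete {x : Config n₁ n₂} (h : x.IsFeasible) {v : Server n₁ n₂}
    (hv : Sum.inl v ∈ x.line) : (x.complete v).IsFeasible := by
  rcases h.exists_complete hv with ⟨P, R, I, rfl, hw⟩ | ⟨P, R₁, c, R₂, I, rfl, hw, hc⟩
  · rw [complete_of_not_waiting I h.notMem.1 hw]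
    rw [isFeasible_iff] at h ⊢
    refine ⟨fun u => ?_, ?_, ?_⟩
    · have := h.1 u
      simp only [List.count_append, List.count_cons, beq_iff_eq,
        Sum.inl.injEq] at this ⊢
      omega
    · exact h.2.1.sublist (by simp)
    · intro d hd u hu
      rcases List.mem_cons.1 hu with rfl | hu
      · exact hw _ hd
      · refine h.2.2 d ?_ u hu
        simp only [List.mem_append, List.mem_cons] at hd ⊢
        tauto
  · rw [complete_of_waiting I h.notMem.1 hw hc]
    rw [isFeasible_iff] at h ⊢
    refine ⟨fun u => ?_, ?_, ?_⟩
    · have := h.1 u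
      simp only [List.count_append, List.count_cons, beq_iff_eq,
        Sum.inl.injEq, reduceCtorEq, if_false] at this ⊢
      omega
    · have h2 := h.2.1
      simp only [List.pairwise_append, List.pairwise_cons, List.mem_append, List.mem_cons] at h2 ⊢
      obtain ⟨h3, ⟨h4, h5, ⟨h6, h7⟩, h8⟩, h9⟩ := h2
      refine ⟨⟨h3, h5, fun a ha b hb => h9 a ha b (by tauto)⟩, ⟨fun b _ => Skips.inl_left v b, h7⟩, ?_⟩
      -- `v` has moved back past `R₁`, so the only new restrictions are those between customers of
      -- `R₁` and `v`; `hw` covers them.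
      rintro a ha b (rfl | hb) d u hd hu
      · subst hd
        obtain rfl := Sum.inl_injective hu
        exact hw (Sum.inr d) (by simpa using ha)
      · rcases ha with ha | ha
        · exact h9 a ha b (by tauto) d u hd hu
        · exact h8 a ha b (by tauto) d u hd hu
    · intro d hd u hu
      refine h.2.2 d ?_ u hu
      simp only [List.mem_append, List.mem_cons, reduceCtorEq, false_or] at hd ⊢
      tauto

end Config

/-! ### Insertion into lists, sums over predecessors, and busy servers. -/

section Lists

variable {α : Type*}

theorem insertIdx_eq_append {l : List α} {k : ℕ} (hk : k ≤ l.length) (v : α) :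
    l.insertIdx k v = l.take k ++ v :: l.drop k := by
  induction l generalizing k with
  | nil =>
    obtain rfl : k = 0 := by simpa using hk
    simp
  | cons a l ih =>
    cases k with
    | zero => simp
    | succ k => simp [ih (k := k) (by simpa using hk)]

theorem append_cons_inj {v : α} {A A' B B' : List α} (h : A ++ v :: B = A' ++ v :: B')
    (hA : v ∉ A) (hA' : v ∉ A') : A = A' ∧ B = B' := by
  induction A generalizing A' with
  | nil =>
    cases A' with
    | nil => simpa using h
    | cons a A' =>
      rw [List.nil_append, List.cons_append, List.cons.injEq] at h
      exact absurd (by simp [h.1]) hA'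
  | cons a A ih =>
    cases A' with
    | nil =>
      rw [List.nil_append, List.cons_append, List.cons.injEq] at h
      exact absurd (by simp [h.1]) hA
    | cons a' A' =>
      rw [List.cons_append, List.cons_append, List.cons.injEq] at h
      obtain ⟨h1, h2⟩ := ih h.2 (fun h' => hA (by simp [h'])) (fun h' => hA' (by simp [h']))
      simp [h.1, h1, h2]

theorem insertIdx_inj {l : List α} {v : α} (hv : v ∉ l) {k k' : ℕ} (hk : k ≤ l.length)
    (hk' : k' ≤ l.length) (h : l.insertIdx k v = l.insertIdx k' v) : k = k' := by
  rw [insertIdx_eq_append hk, insertIdx_eq_append hk'] at h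
  have := (append_cons_inj h (fun h' => hv (List.mem_of_mem_take h'))
    (fun h' => hv (List.mem_of_mem_take h'))).1
  have := congrArg List.length this
  simp only [List.length_take] at this
  omega

end Lists

/-- Only finitely many configurations send flow into a given one. Here `g` enumerates the possible
predecessors without repetition, which makes the balance sums finite. -/
theorem hasSum_feasible {ι : Type*} {F : Config n₁ n₂ → ℝ} (s : Finset ι) (g : ι → Config n₁ n₂)
    (hg : Set.InjOn g s) (hf : ∀ i ∈ s, (g i).IsFeasible)
    (h0 : ∀ y : Config n₁ n₂, y.IsFeasible → F y ≠ 0 → ∃ i ∈ s, g i = y) :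
    HasSum (fun y : Feasible n₁ n₂ => F y.1) (∑ i ∈ s, F (g i)) := by
  classical
  let g' : s → Feasible n₁ n₂ := fun i => ⟨g i.1, hf i.1 i.2⟩
  have hg' : Function.Injective g' := fun i j hij =>
    Subtype.ext (hg i.2 j.2 (congrArg Subtype.val hij))
  have h1 : ∑ i ∈ s, F (g i) = ∑ y ∈ s.attach.image g', F y.1 := by
    rw [Finset.sum_image hg'.injOn, ← Finset.sum_attach]
  rw [h1]
  refine hasSum_sum_of_ne_finset_zero fun y hy => ?_
  by_contra h
  obtain ⟨i, hi, hiy⟩ := h0 y.1 y.2 h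
  exact hy (Finset.mem_image.2 ⟨⟨i, hi⟩, by simp, Subtype.ext hiy⟩)

/-- The busy servers of a line. -/
def busyServers (L : List (Item n₁ n₂)) : List (Server n₁ n₂) :=
  L.filterMap Sum.getLeft?

theorem mem_busyServers {L : List (Item n₁ n₂)} {v : Server n₁ n₂} :
    v ∈ busyServers L ↔ Sum.inl v ∈ L := by
  simp [busyServers, List.mem_filterMap]

theorem count_busyServers (L : List (Item n₁ n₂)) (v : Server n₁ n₂) :
    (busyServers L).count v = L.count (Sum.inl v) := by
  induction L with
  | nil => rfl
  | cons z L ih =>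
    cases z with
    | inl u =>
      change (u :: busyServers L).count v = _
      rw [List.count_cons, List.count_cons, ih]
      rfl
    | inr c =>
      change (busyServers L).count v = _
      rw [List.count_cons, ih]
      rfl

theorem sum_map_busyServers (mu : Server n₁ n₂ → ℝ) (L : List (Item n₁ n₂)) :
    ((busyServers L).map mu).sum = busyRate mu L := by
  induction L with
  | nil => rfl
  | cons z L ih =>
    cases z with
    | inl u =>
      change ((u :: busyServers L).map mu).sum = mu u + busyRate mu L
      rw [List.map_cons, List.sum_cons, ih]
    | inr c => exact ih

theorem busyRate_nonneg {mu : Server n₁ n₂ → ℝ} (hmu : ∀ v, 0 < mu v) (L : List (Item n₁ n₂)) :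
    0 ≤ busyRate mu L := by
  rw [← sum_map_busyServers]
  refine List.sum_nonneg fun r hr => ?_
  obtain ⟨v, -, rfl⟩ := List.mem_map.1 hr
  exact (hmu v).le

namespace Config

theorem IsFeasible.nodup {L : List (Item n₁ n₂)} {I : List (Server n₁ n₂)}
    (h : (⟨L, I⟩ : Config n₁ n₂).IsFeasible) : (busyServers L ++ I).Nodup := by
  rw [List.nodup_iff_count_le_one]
  intro v
  rw [List.count_append, count_busyServers]
  exact (((isFeasible_iff _ _).1 h).1 v).le

theorem IsFeasible.mem {L : List (Item n₁ n₂)} {I : List (Server n₁ n₂)}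
    (h : (⟨L, I⟩ : Config n₁ n₂).IsFeasible) (v : Server n₁ n₂) : Sum.inl v ∈ L ∨ v ∈ I := by
  have := ((isFeasible_iff _ _).1 h).1 v
  by_contra! h'
  rw [List.count_eq_zero.2 h'.1, List.count_eq_zero.2 h'.2] at this
  omega

theorem IsFeasible.sum_eq {L : List (Item n₁ n₂)} {I : List (Server n₁ n₂)}
    (h : (⟨L, I⟩ : Config n₁ n₂).IsFeasible) (f : Server n₁ n₂ → ℝ) :
    ∑ v, f v = ((busyServers L).map f).sum + (I.map f).sum := by
  rw [← List.sum_append, ← List.map_append, ← List.sum_toFinset _ h.nodup]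
  refine Finset.sum_congr (Finset.ext fun v => ?_) fun _ _ => rfl
  have := h.mem v
  simpa [mem_busyServers]

/-- A customer at the front would have been skipped by every server, yet a server of type `s₁`
serves everyone. Thus the factor `lam c / m` never occurs with `m = 0`. -/
theorem IsFeasible.ne_cons (hn₁ : 0 < n₁) {L : List (Item n₁ n₂)} {I : List (Server n₁ n₂)}
    (h : (⟨L, I⟩ : Config n₁ n₂).IsFeasible) (c : Customer) (L' : List (Item n₁ n₂)) :
    L ≠ Sum.inr c :: L' := by
  rintro rfl
  have hm := h.mem (Sum.inl ⟨0, hn₁⟩)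
  rw [isFeasible_iff] at h
  rcases hm with hm | hm
  · have := (List.pairwise_cons.1 h.2.1).1 _ (by simpa using hm) c _ rfl rfl
    simp [canServe] at this
  · have := h.2.2 c (by simp) _ hm
    simp [canServe] at this

theorem IsFeasible.ne_cons_of_append (hn₁ : 0 < n₁) {P R : List (Item n₁ n₂)}
    {I : List (Server n₁ n₂)} {v : Server n₁ n₂}
    (h : (⟨P ++ Sum.inl v :: R, I⟩ : Config n₁ n₂).IsFeasible) (c : Customer)
    (L' : List (Item n₁ n₂)) : P ≠ Sum.inr c :: L' := by
  rintro rfl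
  exact h.ne_cons hn₁ c _ rfl

theorem IsFeasible.busyRate_pos (hn₁ : 0 < n₁) {mu : Server n₁ n₂ → ℝ} (hmu : ∀ v, 0 < mu v)
    {L : List (Item n₁ n₂)} {I : List (Server n₁ n₂)}
    (h : (⟨L, I⟩ : Config n₁ n₂).IsFeasible) (hL : L ≠ []) : 0 < busyRate mu L := by
  cases L with
  | nil => exact absurd rfl hL
  | cons z L =>
    cases z with
    | inl v => exact add_pos_of_pos_of_nonneg (hmu v) (busyRate_nonneg hmu L)
    | inr c => exact absurd rfl (h.ne_cons hn₁ c L)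

/-! ### Partial balance: arrivals against completions. -/

variable {lam : Customer → ℝ} {mu : Server n₁ n₂ → ℝ}

-- The only predecessor lacks the last customer, whose factor is `lam c` over the busy rate;
-- multiplying by these two rates gives equal flows.
open Classical in
theorem hasSum_arrive_customer (hn₁ : 0 < n₁) (hmu : ∀ v, 0 < mu v)
    {L : List (Item n₁ n₂)} {c : Customer} {I : List (Server n₁ n₂)}
    (h : (⟨L ++ [Sum.inr c], I⟩ : Config n₁ n₂).IsFeasible) :
    HasSum (fun y : Feasible n₁ n₂ => y.1.weight lam mu *
        ∑ d, if y.1.arrive d = ⟨L ++ [Sum.inr c], I⟩ then lam d else 0)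
      ((⟨L ++ [Sum.inr c], I⟩ : Config n₁ n₂).weight lam mu *
        busyRate mu (L ++ [Sum.inr c])) := by
  have hpos := h.busyRate_pos hn₁ hmu (by simp)
  have h' := (isFeasible_iff _ _).1 h
  have hI := h'.2.2 c (by simp)
  have hy : (⟨L, I⟩ : Config n₁ n₂).IsFeasible := by
    rw [isFeasible_iff]
    refine ⟨fun v => ?_, (List.pairwise_append.1 h'.2.1).1,
      fun d hd => h'.2.2 d (by simp [hd])⟩
    have := h'.1 v
    rw [List.count_append] at this
    exact this
  have key := hasSum_feasible (F := fun y : Config n₁ n₂ => y.weight lam mu *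
      ∑ d, if y.arrive d = ⟨L ++ [Sum.inr c], I⟩ then lam d else 0) {()} (fun _ => ⟨L, I⟩)
    (by simp) (by simpa using hy) ?_
  · convert key using 1
    rw [Finset.sum_singleton, Finset.sum_eq_single c]
    · rw [arrive_of_not_served L hI, if_pos rfl]
      rw [busyRate_append] at hpos ⊢
      simp only [weight, lineWeight_append, lineWeight, busyRate, add_zero] at hpos ⊢
      simp only [zero_add]
      field_simp
    · intro d _ hd
      rw [if_neg]
      rcases served_or_not_served d I with hI' | ⟨A, v, B, rfl, hv, hB⟩
      · rw [arrive_of_not_served L hI']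
        simpa using hd
      · rw [arrive_of_served L hv hB hy.notMem_idle.2.1]
        simp
    · simp
  · rintro ⟨L', I'⟩ hy' hF
    obtain ⟨d, -, hd⟩ := Finset.exists_ne_zero_of_sum_ne_zero (right_ne_zero_of_mul hF)
    have hd' := of_not_not fun h => hd (if_neg h)
    refine ⟨(), by simp, ?_⟩
    rcases served_or_not_served d I' with hI' | ⟨A, v, B, rfl, hv, hB⟩
    · rw [arrive_of_not_served L' hI', Config.mk.injEq] at hd'
      rw [(List.append_inj' hd'.1 rfl).1, hd'.2]
    · rw [arrive_of_served L' hv hB hy'.notMem_idle.2.1, Config.mk.injEq] at hd'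
      have := (List.append_inj' hd'.1 rfl).2
      simp at this

-- Before the arrival `v` stood at some place `k` of the idle list, and `servedRate_cons_sub` is the
-- rate at which arrivals reached it there. The insertion identity sums over `k`; the factor of `v`
-- in the line is the reciprocal of the busy rate.
open Classical in
theorem hasSum_arrive_server (hn₁ : 0 < n₁) (hlam : ∀ c, 0 < lam c) (hmu : ∀ v, 0 < mu v)
    {L : List (Item n₁ n₂)} {v : Server n₁ n₂} {I : List (Server n₁ n₂)}
    (h : (⟨L ++ [Sum.inl v], I⟩ : Config n₁ n₂).IsFeasible) :
    HasSum (fun y : Feasible n₁ n₂ => y.1.weight lam mu *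
        ∑ d, if y.1.arrive d = ⟨L ++ [Sum.inl v], I⟩ then lam d else 0)
      ((⟨L ++ [Sum.inl v], I⟩ : Config n₁ n₂).weight lam mu *
        busyRate mu (L ++ [Sum.inl v])) := by
  have hpos := h.busyRate_pos hn₁ hmu (by simp)
  have h' := (isFeasible_iff _ _).1 h
  have hvI := h.notMem.2.2
  have hy : ∀ A B, I = A ++ B → (⟨L, A ++ v :: B⟩ : Config n₁ n₂).IsFeasible := by
    rintro A B rfl
    rw [isFeasible_iff]
    have h3 := List.pairwise_append.1 h'.2.1
    refine ⟨fun u => ?_, h3.1, fun d hd u hu => ?_⟩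
    · have := h'.1 u
      rw [← this]
      simp only [List.count_append, List.count_cons, List.count_nil]
      -- Both sides must show the same conditional, which `omega` treats as an atom.
      change _ + (_ + (_ + if (v == u) = true then 1 else 0)) =
        _ + (0 + if (v == u) = true then 1 else 0) + _
      omega
    · by_cases huv : u = v
      · exact h3.2.2 _ hd (Sum.inl v) (by simp) d u rfl (by rw [huv])
      · refine h'.2.2 d (by simp [hd]) u ?_
        simp only [List.mem_append, List.mem_cons] at hu ⊢
        tauto
  have key := hasSum_feasible (F := fun y : Config n₁ n₂ => y.weight lam mu *
      ∑ d, if y.arrive d = ⟨L ++ [Sum.inl v], I⟩ then lam d else 0)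
    (Finset.range (I.length + 1)) (fun k => ⟨L, I.insertIdx k v⟩) ?_ ?_ ?_
  · convert key using 1
    have h1 : ∀ k ∈ Finset.range (I.length + 1),
        ((⟨L, I.insertIdx k v⟩ : Config n₁ n₂).weight lam mu * ∑ d,
          if (⟨L, I.insertIdx k v⟩ : Config n₁ n₂).arrive d = ⟨L ++ [Sum.inl v], I⟩
          then lam d else 0) =
        lineWeight lam mu 0 L * (idleWeight lam (I.insertIdx k v) *
          (servedRate lam (v :: I.drop k) - servedRate lam (I.drop k))) := by
      intro k hk
      have hk' : k ≤ I.length := by simpa [Nat.lt_succ_iff] using hk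
      have hyk := hy _ _ (List.take_append_drop k I).symm
      rw [weight, mul_assoc, servedRate_cons_sub]
      congr 3
      ext d
      have hiff : (⟨L, I.insertIdx k v⟩ : Config n₁ n₂).arrive d = ⟨L ++ [Sum.inl v], I⟩ ↔
          canServe v d = true ∧ ∀ u ∈ I.drop k, canServe u d = false := by
        rw [insertIdx_eq_append hk']
        constructor
        · intro hd
          rcases served_or_not_served d (I.take k ++ v :: I.drop k) with
            hI' | ⟨A, u, B, hAB, hu, hB⟩
          · rw [arrive_of_not_served L hI'] at hd
            simp at hd
          · rw [hAB] at hd hyk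
            rw [arrive_of_served L hu hB hyk.notMem_idle.2.1, Config.mk.injEq] at hd
            obtain rfl : u = v := by simpa using hd.1
            have := append_cons_inj hAB (fun h' => hvI (List.mem_of_mem_take h'))
              hyk.notMem_idle.2.1
            rw [this.2]
            exact ⟨hu, hB⟩
        · rintro ⟨hd1, hd2⟩
          rw [arrive_of_served L hd1 hd2 fun h' => hvI (List.mem_of_mem_take h'),
            List.take_append_drop]
      by_cases hd : canServe v d = true ∧ ∀ u ∈ I.drop k, canServe u d = false
      · rw [if_pos (hiff.2 hd), if_pos hd]
      · rw [if_neg (mt hiff.1 hd), if_neg hd]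
    rw [Finset.sum_congr rfl h1, ← Finset.mul_sum, sum_idleWeight_insertIdx hlam]
    rw [busyRate_append] at hpos ⊢
    simp only [weight, lineWeight_append, lineWeight, busyRate, add_zero] at hpos ⊢
    simp only [zero_add]
    field_simp
  · intro k hk k' hk' hkk
    simp only [Finset.coe_range, Set.mem_Iio, Nat.lt_succ_iff] at hk hk'
    exact insertIdx_inj hvI hk hk' (by simpa using hkk)
  · intro k hk
    have hk' : k ≤ I.length := by simpa [Nat.lt_succ_iff] using hk
    rw [insertIdx_eq_append hk']
    exact hy _ _ (List.take_append_drop k I).symm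
  · rintro ⟨L', I'⟩ hy' hF
    obtain ⟨d, -, hd⟩ := Finset.exists_ne_zero_of_sum_ne_zero (right_ne_zero_of_mul hF)
    have hd' := of_not_not fun h => hd (if_neg h)
    rcases served_or_not_served d I' with hI' | ⟨A, u, B, rfl, hu, hB⟩
    · rw [arrive_of_not_served L' hI', Config.mk.injEq] at hd'
      have := (List.append_inj' hd'.1 rfl).2
      simp at this
    · rw [arrive_of_served L' hu hB hy'.notMem_idle.2.1, Config.mk.injEq] at hd'
      have h1 := List.append_inj' hd'.1 rfl
      obtain rfl : u = v := by simpa using h1.2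
      refine ⟨A.length, ?_, ?_⟩
      · rw [← hd'.2]
        simp
      · rw [h1.1, ← hd'.2, insertIdx_eq_append (by simp)]
        simp

open Classical in
theorem hasSum_arrive (hn₁ : 0 < n₁) (hlam : ∀ c, 0 < lam c) (hmu : ∀ v, 0 < mu v)
    {x : Config n₁ n₂} (h : x.IsFeasible) :
    HasSum (fun y : Feasible n₁ n₂ => y.1.weight lam mu *
        ∑ d, if y.1.arrive d = x then lam d else 0) (x.weight lam mu * busyRate mu x.line) := by
  obtain ⟨L, I⟩ := x
  rcases List.eq_nil_or_concat L with rfl | ⟨L, z, rfl⟩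
  -- No arrival leaves an empty line, and the busy rate of an empty line is 0.
  · rw [busyRate, mul_zero]
    convert hasSum_zero with y
    refine mul_eq_zero_of_right _ (Finset.sum_eq_zero fun d _ => if_neg ?_)
    obtain ⟨⟨L', I'⟩, hy⟩ := y
    rcases served_or_not_served d I' with hI' | ⟨A, u, B, rfl, hu, hB⟩
    · simp [arrive_of_not_served L' hI']
    · simp [arrive_of_served L' hu hB hy.notMem_idle.2.1]
  · rw [List.concat_eq_append] at h ⊢
    cases z with
    | inl v => exact hasSum_arrive_server hn₁ hlam hmu h
    | inr c => exact hasSum_arrive_customer hn₁ hmu h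

end Config

/-! ### Partial balance: completions against arrivals. -/

namespace Config

variable {lam : Customer → ℝ} {mu : Server n₁ n₂ → ℝ}

theorem isFeasible_of_complete_customer {P R : List (Item n₁ n₂)} {v : Server n₁ n₂}
    {c : Customer} {I : List (Server n₁ n₂)}
    (h : (⟨P ++ Sum.inl v :: R, I⟩ : Config n₁ n₂).IsFeasible)
    (hc : ∀ u ∈ busyServers R ++ I, canServe u c = false) (P₁ P₂ : List (Item n₁ n₂))
    (hP : P = P₁ ++ P₂) :
    (⟨P₁ ++ Sum.inl v :: (P₂ ++ Sum.inr c :: R), I⟩ : Config n₁ n₂).IsFeasible := by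
  subst hP
  have hw := h.not_waiting
  rw [isFeasible_iff] at h ⊢
  refine ⟨fun u => ?_, ?_, ?_⟩
  · have := h.1 u
    simp only [List.count_append, List.count_cons, beq_iff_eq, reduceCtorEq, if_false] at this ⊢
    omega
  · have h2 := h.2.1
    simp only [List.pairwise_append, List.pairwise_cons, List.mem_append, List.mem_cons] at h2 ⊢
    obtain ⟨⟨h3, h4, h5⟩, ⟨-, h6⟩, h7⟩ := h2
    refine ⟨h3, ⟨fun b _ => Skips.inl_left v b, h4, ⟨?_, h6⟩, ?_⟩, ?_⟩
    · rintro b hb d u hd rfl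
      obtain rfl := Sum.inr_injective hd
      exact hc u (List.mem_append.2 (Or.inl (mem_busyServers.2 hb)))
    · rintro a ha b (rfl | hb)
      · exact Skips.inr_right a c
      · exact h7 a (Or.inr ha) b (Or.inr hb)
    · rintro a ha b (rfl | hb | rfl | hb)
      · exact h7 a (Or.inl ha) _ (Or.inl rfl)
      · exact h5 a ha b hb
      · exact Skips.inr_right a c
      · exact h7 a (Or.inl ha) b (Or.inr hb)
  · intro d hd u hu
    simp only [List.mem_append, List.mem_cons, reduceCtorEq, false_or, Sum.inr.injEq] at hd
    by_cases hdc : d = c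
    · exact hdc ▸ hc u (by simp [hu])
    · refine h.2.2 d ?_ u hu
      simp only [List.mem_append, List.mem_cons]
      tauto

theorem isFeasible_of_complete_idle {P R : List (Item n₁ n₂)} {v : Server n₁ n₂}
    {I : List (Server n₁ n₂)} (h : (⟨P ++ R, v :: I⟩ : Config n₁ n₂).IsFeasible) :
    (⟨P ++ Sum.inl v :: R, I⟩ : Config n₁ n₂).IsFeasible := by
  rw [isFeasible_iff] at h ⊢
  refine ⟨fun u => ?_, ?_, ?_⟩
  · have := h.1 u
    rw [← this]
    simp only [List.count_append, List.count_cons]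
    change _ + (_ + if (v == u) = true then 1 else 0) + _ =
        _ + _ + (_ + if (v == u) = true then 1 else 0)
    omega
  · have h2 := h.2.1
    simp only [List.pairwise_append, List.pairwise_cons, List.mem_cons] at h2 ⊢
    refine ⟨h2.1, ⟨fun b _ => Skips.inl_left v b, h2.2.1⟩, ?_⟩
    rintro a ha b (rfl | hb)
    · rintro d u rfl hu
      obtain rfl := Sum.inl_injective hu
      exact h.2.2 d (by simp [ha]) _ (by simp)
    · exact h2.2.2 a ha b hb
  · intro d hd u hu
    refine h.2.2 d ?_ u (by simp [hu])
    simpa using hd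

-- Before `v` took its present customer `c`, he waited at the place where `v` is now, and `v` stood
-- at an arbitrary place of `P`. His type is one that `v` serves but no server in `R` or `I` does.
-- Summing over the places of `v` restores the line weight; summing over `c` gives the difference of
-- served rates.
open Classical in
theorem hasSum_complete_busy (hn₁ : 0 < n₁) (hmu : ∀ v, 0 < mu v)
    {P R : List (Item n₁ n₂)} {v : Server n₁ n₂} {I : List (Server n₁ n₂)}
    (h : (⟨P ++ Sum.inl v :: R, I⟩ : Config n₁ n₂).IsFeasible) :
    HasSum (fun y : Feasible n₁ n₂ => y.1.weight lam mu *
        if Sum.inl v ∈ y.1.line ∧ y.1.complete v = ⟨P ++ Sum.inl v :: R, I⟩ then mu v else 0)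
      ((⟨P ++ Sum.inl v :: R, I⟩ : Config n₁ n₂).weight lam mu *
        (servedRate lam (v :: (busyServers R ++ I)) - servedRate lam (busyServers R ++ I))) := by
  have hv := h.notMem
  set S : Finset Customer := Finset.univ.filter fun c =>
    canServe v c = true ∧ ∀ u ∈ busyServers R ++ I, canServe u c = false with hS
  have hmem : ∀ {c : Customer} {k : ℕ}, (c, k) ∈ S ×ˢ Finset.range (P.length + 1) ↔
      (canServe v c = true ∧ ∀ u ∈ busyServers R ++ I, canServe u c = false) ∧ k ≤ P.length := by
    intro c k
    simp [hS]
  have key := hasSum_feasible (F := fun y : Config n₁ n₂ => y.weight lam mu *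
      if Sum.inl v ∈ y.line ∧ y.complete v = ⟨P ++ Sum.inl v :: R, I⟩ then mu v else 0)
    (S ×ˢ Finset.range (P.length + 1))
    (fun i => ⟨P.insertIdx i.2 (Sum.inl v) ++ Sum.inr i.1 :: R, I⟩) ?_ ?_ ?_
  · convert key using 1
    have h1 : ∀ i ∈ S ×ˢ Finset.range (P.length + 1),
        ((⟨P.insertIdx i.2 (Sum.inl v) ++ Sum.inr i.1 :: R, I⟩ : Config n₁ n₂).weight lam mu *
          if Sum.inl v ∈ (⟨P.insertIdx i.2 (Sum.inl v) ++ Sum.inr i.1 :: R, I⟩ :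
              Config n₁ n₂).line ∧
            (⟨P.insertIdx i.2 (Sum.inl v) ++ Sum.inr i.1 :: R, I⟩ : Config n₁ n₂).complete v =
              ⟨P ++ Sum.inl v :: R, I⟩ then mu v else 0) =
        lam i.1 * ((mu v * lineWeight lam mu 0 (P.insertIdx i.2 (Sum.inl v))) *
          ((busyRate mu P + mu v)⁻¹ * lineWeight lam mu (busyRate mu P + mu v) R *
            idleWeight lam I)) := by
      rintro ⟨c, k⟩ hi
      obtain ⟨⟨hc, hc'⟩, hk⟩ := hmem.1 hi
      rw [if_pos]
      · simp only [weight, lineWeight_append, lineWeight, busyRate_insertIdx v P hk, zero_add]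
        ring
      · simp only [insertIdx_eq_append hk, List.append_assoc, List.cons_append]
        refine ⟨by simp, ?_⟩
        rw [complete_of_waiting I (fun h' => hv.1 (List.mem_of_mem_take h')) _ hc,
          List.take_append_drop]
        rw [List.take_append_drop]
        exact h.not_waiting
    rw [Finset.sum_congr rfl h1, Finset.sum_product]
    simp only [← Finset.mul_sum, ← Finset.sum_mul]
    have h2 := sum_lineWeight_insertIdx (lam := lam) hmu v P (h.ne_cons_of_append hn₁)
    have h3 : servedRate lam (v :: (busyServers R ++ I)) - servedRate lam (busyServers R ++ I) =
        ∑ c ∈ S, lam c := by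
      rw [servedRate_cons_sub, Finset.sum_filter]
      exact Finset.sum_congr rfl fun c _ => by congr
    rw [← Finset.mul_sum] at h2
    rw [h2, h3]
    simp only [weight, lineWeight_append, lineWeight, zero_add]
    ring
  · rintro ⟨c, k⟩ hi ⟨c', k'⟩ hi' hii
    obtain ⟨-, hk⟩ := hmem.1 hi
    obtain ⟨-, hk'⟩ := hmem.1 hi'
    rw [Config.mk.injEq] at hii
    have h1 := List.append_inj hii.1
      (by rw [List.length_insertIdx_of_le_length hk, List.length_insertIdx_of_le_length hk'])
    rw [insertIdx_inj hv.1 hk hk' h1.1]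
    simpa using h1.2
  · rintro ⟨c, k⟩ hi
    obtain ⟨⟨hc, hc'⟩, hk⟩ := hmem.1 hi
    simp only [insertIdx_eq_append hk, List.append_assoc, List.cons_append]
    exact isFeasible_of_complete_customer h hc' _ _ (List.take_append_drop k P).symm
  · intro y hy hF
    have hF' := of_not_not fun h => right_ne_zero_of_mul hF (if_neg h)
    rcases hy.exists_complete hF'.1 with ⟨P', R', I', rfl, hw'⟩ | ⟨P', R₁, c, R₂, I', rfl, hw', hc⟩
    · have h2 := hF'.2
      rw [complete_of_not_waiting I' hy.notMem.1 hw', Config.mk.injEq] at h2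
      exact absurd (by simp [← h2.2]) hv.2.2
    · have h2 := hF'.2
      have hy' := hy.notMem
      simp only [List.mem_append, not_or] at hy'
      rw [complete_of_waiting I' hy'.1 hw' hc, Config.mk.injEq] at h2
      obtain ⟨h3, rfl⟩ := append_cons_inj h2.1 (by simp [hy'.1, hy'.2.1.1]) hv.1
      obtain rfl := h2.2
      refine ⟨(c, P'.length), hmem.2 ⟨⟨hc, ?_⟩, ?_⟩, ?_⟩
      · rw [isFeasible_iff] at hy
        intro u hu
        rcases List.mem_append.1 hu with hu | hu
        · have h4 := (List.pairwise_append.1 hy.2.1).2.1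
          have h5 := (List.pairwise_append.1 (List.pairwise_cons.1 h4).2).2.1
          exact (List.pairwise_cons.1 h5).1 _ (mem_busyServers.1 hu) c u rfl rfl
        · exact hy.2.2 c (by simp) u hu
      · simp [← h3]
      · rw [insertIdx_eq_append (by simp [← h3]), ← h3]
        simp

-- The most recently idle server found no compatible customer when it stopped, and stood anywhere in
-- the line before. Its idle factor is the reciprocal of `servedRate lam (v :: I)`.
open Classical in
theorem hasSum_complete_head (hn₁ : 0 < n₁) (hlam : ∀ c, 0 < lam c) (hmu : ∀ v, 0 < mu v)
    {L : List (Item n₁ n₂)} {v : Server n₁ n₂} {I : List (Server n₁ n₂)}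
    (h : (⟨L, v :: I⟩ : Config n₁ n₂).IsFeasible) :
    HasSum (fun y : Feasible n₁ n₂ => y.1.weight lam mu *
        if Sum.inl v ∈ y.1.line ∧ y.1.complete v = ⟨L, v :: I⟩ then mu v else 0)
      ((⟨L, v :: I⟩ : Config n₁ n₂).weight lam mu * servedRate lam (v :: I)) := by
  have hv : Sum.inl v ∉ L := (h.notMem_idle (A := [])).1
  have hw : ∀ z ∈ L, isWaitingFor v z = false := by
    intro z hz
    cases z with
    | inl u => rfl
    | inr c => exact ((isFeasible_iff _ _).1 h).2.2 c hz v (by simp)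
  have key := hasSum_feasible (F := fun y : Config n₁ n₂ => y.weight lam mu *
      if Sum.inl v ∈ y.line ∧ y.complete v = ⟨L, v :: I⟩ then mu v else 0)
    (Finset.range (L.length + 1)) (fun k => ⟨L.insertIdx k (Sum.inl v), I⟩) ?_ ?_ ?_
  · convert key using 1
    have h1 : ∀ k ∈ Finset.range (L.length + 1),
        ((⟨L.insertIdx k (Sum.inl v), I⟩ : Config n₁ n₂).weight lam mu *
          if Sum.inl v ∈ (⟨L.insertIdx k (Sum.inl v), I⟩ : Config n₁ n₂).line ∧
            (⟨L.insertIdx k (Sum.inl v), I⟩ : Config n₁ n₂).complete v = ⟨L, v :: I⟩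
          then mu v else 0) =
        (mu v * lineWeight lam mu 0 (L.insertIdx k (Sum.inl v))) * idleWeight lam I := by
      intro k hk
      have hk' : k ≤ L.length := by simpa [Nat.lt_succ_iff] using hk
      rw [if_pos]
      · rw [weight]
        ring
      · simp only [insertIdx_eq_append hk']
        refine ⟨by simp, ?_⟩
        rw [complete_of_not_waiting I (fun h' => hv (List.mem_of_mem_take h')),
          List.take_append_drop]
        rwa [List.take_append_drop]
    rw [Finset.sum_congr rfl h1, ← Finset.sum_mul,
      sum_lineWeight_insertIdx hmu v L (h.ne_cons hn₁)]
    have := servedRate_cons_pos hlam v I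
    simp only [weight, idleWeight]
    field_simp
  · intro k hk k' hk' hkk
    simp only [Finset.coe_range, Set.mem_Iio, Nat.lt_succ_iff] at hk hk'
    exact insertIdx_inj hv hk hk' (by simpa using hkk)
  · intro k hk
    have hk' : k ≤ L.length := by simpa [Nat.lt_succ_iff] using hk
    rw [insertIdx_eq_append hk']
    exact isFeasible_of_complete_idle (by rwa [List.take_append_drop])
  · intro y hy hF
    have hF' := of_not_not fun h => right_ne_zero_of_mul hF (if_neg h)
    have h2 := hF'.2
    rcases hy.exists_complete hF'.1 with ⟨P', R', I', rfl, hw'⟩ | ⟨P', R₁, c, R₂, I', rfl, hw', hc⟩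
    · rw [complete_of_not_waiting I' hy.notMem.1 hw', Config.mk.injEq, List.cons.injEq] at h2
      obtain ⟨rfl, -, rfl⟩ := h2
      refine ⟨P'.length, by simp, ?_⟩
      rw [insertIdx_eq_append (by simp)]
      simp
    · rw [complete_of_waiting I' hy.notMem.1 hw' hc, Config.mk.injEq] at h2
      exact absurd (by simp [← h2.1]) hv

-- A server that has just completed is either busy or at the head of the idle list, never further
-- down.
open Classical in
theorem hasSum_complete_tail {L : List (Item n₁ n₂)} {u v : Server n₁ n₂}
    {I : List (Server n₁ n₂)} (h : (⟨L, u :: I⟩ : Config n₁ n₂).IsFeasible) (hv : v ∈ I) :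
    HasSum (fun y : Feasible n₁ n₂ => y.1.weight lam mu *
        if Sum.inl v ∈ y.1.line ∧ y.1.complete v = ⟨L, u :: I⟩ then mu v else 0) 0 := by
  convert hasSum_zero with y
  refine mul_eq_zero_of_right _ (if_neg ?_)
  rintro ⟨h1, h2⟩
  obtain ⟨y, hy⟩ := y
  simp only at h1 h2
  rcases hy.exists_complete h1 with ⟨P', R', I', rfl, hw'⟩ | ⟨P', R₁, c, R₂, I', rfl, hw', hc⟩
  · rw [complete_of_not_waiting I' hy.notMem.1 hw', Config.mk.injEq, List.cons.injEq] at h2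
    obtain ⟨rfl, rfl, rfl⟩ := h2
    exact (h.notMem_idle (A := [])).2.2 hv
  · rw [complete_of_waiting I' hy.notMem.1 hw' hc, Config.mk.injEq] at h2
    obtain ⟨A, B, rfl⟩ := List.append_of_mem hv
    exact (h.notMem_idle (A := u :: A)).1 (by simp [← h2.1])

theorem sum_map_telescope (F : Server n₁ n₂ → ℝ) (G : List (Server n₁ n₂) → ℝ)
    (L : List (Item n₁ n₂))
    (h : ∀ P v R, L = P ++ Sum.inl v :: R → F v = G (v :: busyServers R) - G (busyServers R)) :
    ((busyServers L).map F).sum = G (busyServers L) - G [] := by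
  induction L with
  | nil => simp [busyServers]
  | cons z L ih =>
    have ih' := ih fun P v R hL => h (z :: P) v R (by rw [hL, List.cons_append])
    cases z with
    | inl u =>
      change ((u :: busyServers L).map F).sum = G (u :: busyServers L) - _
      rw [List.map_cons, List.sum_cons, ih', h [] u L rfl]
      ring
    | inr c => exact ih'

theorem IsFeasible.servedRate_eq (hn₁ : 0 < n₁) {L : List (Item n₁ n₂)} {I : List (Server n₁ n₂)}
    (h : (⟨L, I⟩ : Config n₁ n₂).IsFeasible) :
    servedRate lam (busyServers L ++ I) = ∑ c, lam c := by
  refine Finset.sum_congr rfl fun c _ => if_pos ⟨Sum.inl ⟨0, hn₁⟩, ?_, rfl⟩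
  simpa [mem_busyServers] using h.mem (Sum.inl ⟨0, hn₁⟩)

-- The busy servers contribute differences of served rates that telescope from the set of all
-- servers down to `I`. The head of `I` contributes the remaining `servedRate lam I`, and all
-- servers together serve every type.
open Classical in
theorem hasSum_complete (hn₁ : 0 < n₁) (hlam : ∀ c, 0 < lam c) (hmu : ∀ v, 0 < mu v)
    {x : Config n₁ n₂} (h : x.IsFeasible) :
    HasSum (fun y : Feasible n₁ n₂ => y.1.weight lam mu *
        ∑ v, if Sum.inl v ∈ y.1.line ∧ y.1.complete v = x then mu v else 0)
      (x.weight lam mu * ∑ c, lam c) := by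
  obtain ⟨L, I⟩ := x
  set f : Server n₁ n₂ → Feasible n₁ n₂ → ℝ := fun v y => y.1.weight lam mu *
    if Sum.inl v ∈ y.1.line ∧ y.1.complete v = ⟨L, I⟩ then mu v else 0 with hf
  have hbusy : ∀ P v R, L = P ++ Sum.inl v :: R → HasSum (f v)
      ((⟨L, I⟩ : Config n₁ n₂).weight lam mu *
        (servedRate lam (v :: (busyServers R ++ I)) - servedRate lam (busyServers R ++ I))) := by
    rintro P v R rfl
    exact hasSum_complete_busy hn₁ hmu h
  have hsum : ∀ v, Summable (f v) := by
    intro v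
    rcases h.mem v with hv | hv
    · obtain ⟨P, R, hL⟩ := List.append_of_mem hv
      exact (hbusy P v R hL).summable
    · cases I with
      | nil => simp at hv
      | cons u I =>
        rcases List.mem_cons.1 hv with rfl | hv
        · exact (hasSum_complete_head hn₁ hlam hmu h).summable
        · exact (hasSum_complete_tail h hv).summable
  have h1 : HasSum (fun y => ∑ v, f v y) (∑ v, ∑' y, f v y) :=
    hasSum_sum fun v _ => (hsum v).hasSum
  simp only [hf, ← Finset.mul_sum] at h1
  convert h1 using 1
  rw [h.sum_eq, sum_map_telescope _ (fun l => (⟨L, I⟩ : Config n₁ n₂).weight lam mu *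
    servedRate lam (l ++ I)) L, h.servedRate_eq hn₁]
  · have h2 : (I.map fun v => ∑' y, f v y).sum =
        (⟨L, I⟩ : Config n₁ n₂).weight lam mu * servedRate lam I := by
      cases I with
      | nil => simp [servedRate_nil]
      | cons u I =>
        rw [List.map_cons, List.sum_cons, (hasSum_complete_head hn₁ hlam hmu h).tsum_eq,
          List.sum_eq_zero, add_zero]
        intro r hr
        obtain ⟨v, hv, rfl⟩ := List.mem_map.1 hr
        exact (hasSum_complete_tail h hv).tsum_eq
    rw [h2]
    simp
  · intro P v R hL
    rw [(hbusy P v R hL).tsum_eq, mul_sub]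
    rfl

end Config

/-! ### Uniqueness of the stationary distribution for bounded rates. -/

section Uniqueness

variable {S : Type*} {q : S → S → ℝ}

/-- Where `a` vanishes, the inflow is a vanishing sum of nonnegative terms, so `a` vanishes at every
predecessor; this propagates backwards along the path. -/
theorem eq_zero_of_reaches {a out : S → ℝ} (hq : ∀ x y, 0 ≤ q x y) (ha : ∀ x, 0 ≤ a x)
    (hb : ∀ x, HasSum (fun y => a y * q y x) (a x * out x)) {x z : S}
    (hz : Relation.ReflTransGen (fun x y => 0 < q x y) x z) (h0 : a z = 0) : a x = 0 := by
  induction hz using Relation.ReflTransGen.head_induction_on with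
  | refl => exact h0
  | @head x y hxy _ ih =>
    have h1 := hb y
    rw [ih, zero_mul, hasSum_zero_iff_of_nonneg fun y => mul_nonneg (ha y) (hq y _)] at h1
    exact (mul_eq_zero.1 (congrFun h1 x)).resolve_right hxy.ne'

/-- The absolute value of a summable solution of the balance equations is again a solution. -/
theorem balance_abs {f out : S → ℝ} {M : ℝ} (hq : ∀ x y, 0 ≤ q x y)
    (hout : ∀ x, HasSum (q x) (out x)) (hM : ∀ x, out x ≤ M) (hf : Summable f)
    (hb : ∀ x, HasSum (fun y => f y * q y x) (f x * out x)) (x : S) :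
    HasSum (fun y => |f y| * q y x) (|f x| * out x) := by
  have hout0 : ∀ x, 0 ≤ out x := fun x => (hout x).nonneg (hq x)
  have hg : Summable fun y => |f y| * out y :=
    Summable.of_nonneg_of_le (fun y => mul_nonneg (abs_nonneg _) (hout0 y))
      (fun y => mul_le_mul_of_nonneg_left (hM y) (abs_nonneg _)) (hf.abs.mul_right M)
  have hrow : ∀ y, HasSum (fun x => |f y| * q y x) (|f y| * out y) :=
    fun y => (hout y).mul_left _
  -- Bounded exit rates make the double family of flows summable, so total inflow and total outflow
  -- of `|f|` coincide.
  have hprod : Summable fun p : S × S => |f p.1| * q p.1 p.2 := by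
    rw [summable_prod_of_nonneg fun p => mul_nonneg (abs_nonneg _) (hq _ _)]
    exact ⟨fun y => (hrow y).summable, by simpa only [(hrow _).tsum_eq] using hg⟩
  have hswap : Summable fun p : S × S => |f p.2| * q p.2 p.1 := hprod.prod_symm
  have hcol : ∀ x, Summable fun y => |f y| * q y x := hswap.prod_factor
  have h1 : HasSum (fun x => ∑' y, |f y| * q y x) (∑' y, |f y| * out y) := by
    have h2 : ∑' p : S × S, |f p.2| * q p.2 p.1 = ∑' y, |f y| * out y := by
      rw [(hprod.hasSum.prod_fiberwise hrow).tsum_eq]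
      exact (Equiv.prodComm S S).tsum_eq fun p : S × S => |f p.1| * q p.1 p.2
    rw [← h2]
    exact hswap.hasSum.prod_fiberwise fun x => (hcol x).hasSum
  -- By the triangle inequality the inflow of `|f|` is at least its outflow at each state. As the
  -- totals agree, equality holds everywhere.
  have hle : ∀ x, 0 ≤ (∑' y, |f y| * q y x) - |f x| * out x := by
    intro x
    have h2 : |∑' y, f y * q y x| ≤ ∑' y, |f y * q y x| := by
      have h3 : Summable fun y => ‖f y * q y x‖ := by
        simpa only [Real.norm_eq_abs, abs_mul, abs_of_nonneg (hq _ _)] using hcol x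
      exact norm_tsum_le_tsum_norm h3
    rw [(hb x).tsum_eq, abs_mul, abs_of_nonneg (hout0 x)] at h2
    simp only [abs_mul, abs_of_nonneg (hq _ _)] at h2
    linarith
  have h3 := h1.sub hg.hasSum
  rw [sub_self, hasSum_zero_iff_of_nonneg hle] at h3
  have h4 : ∑' y, |f y| * q y x = |f x| * out x := sub_eq_zero.1 (congrFun h3 x)
  rw [← h4]
  exact (hcol x).hasSum

/-- A chain with bounded rates has at most one stationary distribution if some state is reached
from all states. -/
theorem IsStationaryDistribution.eq {out p p' : S → ℝ} {M : ℝ} (hq : ∀ x y, 0 ≤ q x y)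
    (hout : ∀ x, HasSum (q x) (out x)) (hM : ∀ x, out x ≤ M) (z : S)
    (hz : ∀ x, Relation.ReflTransGen (fun x y => 0 < q x y) x z)
    (hp : IsStationaryDistribution q p) (hp' : IsStationaryDistribution q p') : p = p' := by
  set f : S → ℝ := fun x => p x - p' x with hf
  have hsum : HasSum f 0 := by simpa using hp.hasSum_one.sub hp'.hasSum_one
  have hb : ∀ x, HasSum (fun y => f y * q y x) (f x * out x) := by
    intro x
    have h1 := (hp.balance x).sub (hp'.balance x)
    rw [(hout x).tsum_eq, ← sub_mul] at h1
    simpa only [hf, sub_mul] using h1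
  have habs := balance_abs hq hout hM hsum.summable hb
  have hplus : ∀ x, HasSum (fun y => (|f y| + f y) * q y x) ((|f x| + f x) * out x) := by
    intro x
    simpa only [add_mul] using (habs x).add (hb x)
  have hminus : ∀ x, HasSum (fun y => (|f y| - f y) * q y x) ((|f x| - f x) * out x) := by
    intro x
    simpa only [sub_mul] using (habs x).sub (hb x)
  have hfz : f = 0 := by
    -- The sign of `f z` makes `|f| + f` or `|f| - f` vanish at `z`, hence everywhere. So `f` has
    -- one sign, and its sum is 0.
    rcases le_total (f z) 0 with h | h
    · have h1 : ∀ x, |f x| + f x = 0 := fun x => eq_zero_of_reaches hq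
        (fun x => by linarith [neg_abs_le (f x)]) hplus (hz x) (by simp [abs_of_nonpos h])
      have h2 : HasSum (fun x => -f x) 0 := by simpa using hsum.neg
      rw [hasSum_zero_iff_of_nonneg fun x => by
        change 0 ≤ -f x
        linarith [h1 x, abs_nonneg (f x)]] at h2
      funext x
      simpa using congrFun h2 x
    · have h1 : ∀ x, |f x| - f x = 0 := fun x => eq_zero_of_reaches hq
        (fun x => by linarith [le_abs_self (f x)]) hminus (hz x) (by simp [abs_of_nonneg h])
      rwa [hasSum_zero_iff_of_nonneg fun x => by
        change 0 ≤ f x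
        linarith [h1 x, abs_nonneg (f x)]] at hsum
  funext x
  exact sub_eq_zero.1 (congrFun hfz x)

end Uniqueness

/-! ### Transition rates, global balance, and reachability of an empty system. -/

/-- The arrival rates as a function of the customer type. -/
def arrivalRate (lam₁ lam₂ : ℝ) : Customer → ℝ
  | Customer.c1 => lam₁
  | Customer.c2 => lam₂

section Rates

variable {lam₁ lam₂ μ₁ μ₂ : ℝ}

theorem arrivalRate_pos (hlam₁ : 0 < lam₁) (hlam₂ : 0 < lam₂) (c : Customer) :
    0 < arrivalRate lam₁ lam₂ c := by
  cases c
  exacts [hlam₁, hlam₂]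

theorem serviceRate_pos (hμ₁ : 0 < μ₁) (hμ₂ : 0 < μ₂) (v : Server n₁ n₂) :
    0 < serviceRate μ₁ μ₂ v := by
  cases v
  exacts [hμ₁, hμ₂]

open Classical in
theorem rate_eq (x y : Feasible n₁ n₂) :
    rate lam₁ lam₂ μ₁ μ₂ x y =
      (∑ c, if x.1.arrive c = y.1 then arrivalRate lam₁ lam₂ c else 0) +
      ∑ v, if Sum.inl v ∈ x.1.line ∧ x.1.complete v = y.1 then serviceRate μ₁ μ₂ v else 0 := by
  rw [Customer.sum_univ]
  simp only [rate, Config.rate, arrivalRate]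
  congr 1
  exact Finset.sum_congr rfl fun v _ => by congr

theorem rate_nonneg (hlam₁ : 0 < lam₁) (hlam₂ : 0 < lam₂) (hμ₁ : 0 < μ₁) (hμ₂ : 0 < μ₂)
    (x y : Feasible n₁ n₂) : 0 ≤ rate lam₁ lam₂ μ₁ μ₂ x y := by
  rw [rate_eq]
  refine add_nonneg (Finset.sum_nonneg fun c _ => ?_) (Finset.sum_nonneg fun v _ => ?_)
  · split_ifs
    exacts [(arrivalRate_pos hlam₁ hlam₂ c).le, le_rfl]
  · split_ifs
    exacts [(serviceRate_pos hμ₁ hμ₂ v).le, le_rfl]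

theorem rate_arrive_pos (hlam₁ : 0 < lam₁) (hlam₂ : 0 < lam₂) (hμ₁ : 0 < μ₁) (hμ₂ : 0 < μ₂)
    {x y : Feasible n₁ n₂} (c : Customer) (h : x.1.arrive c = y.1) :
    0 < rate lam₁ lam₂ μ₁ μ₂ x y := by
  rw [rate_eq]
  refine add_pos_of_pos_of_nonneg (Finset.sum_pos' (fun c _ => ?_) ⟨c, by simp, ?_⟩)
    (Finset.sum_nonneg fun v _ => ?_)
  · split_ifs
    exacts [(arrivalRate_pos hlam₁ hlam₂ c).le, le_rfl]
  · rw [if_pos h]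
    exact arrivalRate_pos hlam₁ hlam₂ c
  · split_ifs
    exacts [(serviceRate_pos hμ₁ hμ₂ v).le, le_rfl]

theorem rate_complete_pos (hlam₁ : 0 < lam₁) (hlam₂ : 0 < lam₂) (hμ₁ : 0 < μ₁) (hμ₂ : 0 < μ₂)
    {x y : Feasible n₁ n₂} {v : Server n₁ n₂} (hv : Sum.inl v ∈ x.1.line)
    (h : x.1.complete v = y.1) : 0 < rate lam₁ lam₂ μ₁ μ₂ x y := by
  rw [rate_eq]
  refine add_pos_of_nonneg_of_pos (Finset.sum_nonneg fun v _ => ?_)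
    (Finset.sum_pos' (fun c _ => ?_) ⟨v, by simp, ?_⟩)
  · split_ifs
    exacts [(arrivalRate_pos hlam₁ hlam₂ _).le, le_rfl]
  · split_ifs
    exacts [(serviceRate_pos hμ₁ hμ₂ _).le, le_rfl]
  · rw [if_pos ⟨hv, h⟩]
    exact serviceRate_pos hμ₁ hμ₂ v

open Classical in
theorem Config.IsFeasible.sum_busy {x : Config n₁ n₂} (h : x.IsFeasible)
    (mu : Server n₁ n₂ → ℝ) :
    (∑ v, if Sum.inl v ∈ x.line then mu v else 0) = busyRate mu x.line := by
  obtain ⟨L, I⟩ := x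
  rw [h.sum_eq, ← sum_map_busyServers]
  have h1 : (I.map fun v => if Sum.inl v ∈ L then mu v else 0).sum = 0 := by
    refine List.sum_eq_zero fun r hr => ?_
    obtain ⟨v, hv, rfl⟩ := List.mem_map.1 hr
    obtain ⟨A, B, rfl⟩ := List.append_of_mem hv
    exact if_neg h.notMem_idle.1
  rw [h1, add_zero]
  congr 1
  exact List.map_congr_left fun v hv => if_pos (mem_busyServers.1 hv)

theorem hasSum_rate (x : Feasible n₁ n₂) :
    HasSum (rate lam₁ lam₂ μ₁ μ₂ x)
      (∑ c, arrivalRate lam₁ lam₂ c + busyRate (serviceRate μ₁ μ₂) x.1.line) := by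
  classical
  rw [← x.2.sum_busy, show rate lam₁ lam₂ μ₁ μ₂ x = _ from funext fun y => rate_eq x y]
  refine HasSum.add (hasSum_sum fun c _ => ?_) (hasSum_sum fun v _ => ?_)
  · convert hasSum_ite_eq (⟨x.1.arrive c, x.2.arrive c⟩ : Feasible n₁ n₂)
      (arrivalRate lam₁ lam₂ c) using 3 with y
    rw [Subtype.ext_iff, eq_comm]
  · by_cases hv : Sum.inl v ∈ x.1.line
    · simp only [hv, true_and, if_true]
      convert hasSum_ite_eq (⟨x.1.complete v, x.2.complete hv⟩ : Feasible n₁ n₂)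
        (serviceRate μ₁ μ₂ v) using 3 with y
      rw [Subtype.ext_iff, eq_comm]
    · simp only [hv, false_and, if_false]
      exact hasSum_zero

theorem busyRate_le (hμ₁ : 0 < μ₁) (hμ₂ : 0 < μ₂) (x : Feasible n₁ n₂) :
    busyRate (serviceRate μ₁ μ₂) x.1.line ≤ ∑ v : Server n₁ n₂, serviceRate μ₁ μ₂ v := by
  classical
  rw [← x.2.sum_busy]
  refine Finset.sum_le_sum fun v _ => ?_
  split_ifs
  exacts [le_rfl, (serviceRate_pos hμ₁ hμ₂ v).le]

/-- The weights satisfy the global balance equations. -/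
theorem hasSum_weight_mul_rate (hn₁ : 0 < n₁) (hlam₁ : 0 < lam₁) (hlam₂ : 0 < lam₂) (hμ₁ : 0 < μ₁)
    (hμ₂ : 0 < μ₂) (x : Feasible n₁ n₂) :
    HasSum (fun y : Feasible n₁ n₂ => y.1.weight (arrivalRate lam₁ lam₂) (serviceRate μ₁ μ₂) *
        rate lam₁ lam₂ μ₁ μ₂ y x)
      (x.1.weight (arrivalRate lam₁ lam₂) (serviceRate μ₁ μ₂) *
        ∑' y, rate lam₁ lam₂ μ₁ μ₂ x y) := by
  rw [(hasSum_rate x).tsum_eq, mul_add, add_comm]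
  simp only [rate_eq, mul_add]
  exact (Config.hasSum_arrive hn₁ (arrivalRate_pos hlam₁ hlam₂) (serviceRate_pos hμ₁ hμ₂) x.2).add
    (Config.hasSum_complete hn₁ (arrivalRate_pos hlam₁ hlam₂) (serviceRate_pos hμ₁ hμ₂) x.2)

/-- Every server can serve `c1`, so each arrival of this type occupies one idle server. -/
theorem reaches_no_idle (hlam₁ : 0 < lam₁) (hlam₂ : 0 < lam₂) (hμ₁ : 0 < μ₁) (hμ₂ : 0 < μ₂)
    (x : Feasible n₁ n₂) : ∃ y : Feasible n₁ n₂, y.1.idle = [] ∧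
      Relation.ReflTransGen (fun x y => 0 < rate lam₁ lam₂ μ₁ μ₂ x y) x y := by
  induction hn : x.1.idle.length generalizing x with
  | zero => exact ⟨x, List.length_eq_zero_iff.1 hn, .refl⟩
  | succ n ih =>
    obtain ⟨⟨L, I⟩, hx⟩ := x
    rcases Config.served_or_not_served Customer.c1 I with hI | ⟨A, v, B, rfl, hv, hB⟩
    · cases I with
      | nil => simp at hn
      | cons u I => simpa [canServe_c1] using hI u (by simp)
    · have hstep := Config.arrive_of_served L hv hB hx.notMem_idle.2.1
      obtain ⟨y, hy, hxy⟩ := ih ⟨⟨L ++ [Sum.inl v], A ++ B⟩, hstep ▸ hx.arrive Customer.c1⟩ (by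
        simp only [List.length_append, List.length_cons] at hn ⊢
        omega)
      exact ⟨y, hy, .head (rate_arrive_pos hlam₁ hlam₂ hμ₁ hμ₂ _ hstep) hxy⟩

/-- With all servers busy, completions at one server of type `s₁` remove the waiting customers one
at a time. -/
theorem reaches_no_queue (hn₁ : 0 < n₁) (hlam₁ : 0 < lam₁) (hlam₂ : 0 < lam₂) (hμ₁ : 0 < μ₁)
    (hμ₂ : 0 < μ₂) (x : Feasible n₁ n₂) (hx : x.1.idle = []) :
    ∃ y : Feasible n₁ n₂, (y.1.idle = [] ∧ ∀ c, Sum.inr c ∉ y.1.line) ∧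
      Relation.ReflTransGen (fun x y => 0 < rate lam₁ lam₂ μ₁ μ₂ x y) x y := by
  induction hn : x.1.line.length generalizing x with
  | zero => exact ⟨x, ⟨hx, by simp [List.length_eq_zero_iff.1 hn]⟩, .refl⟩
  | succ n ih =>
    by_cases hc : ∀ c, Sum.inr c ∉ x.1.line
    · exact ⟨x, ⟨hx, hc⟩, .refl⟩
    · push Not at hc
      obtain ⟨c, hc⟩ := hc
      obtain ⟨x, hxf⟩ := x
      have hv : Sum.inl (Sum.inl ⟨0, hn₁⟩) ∈ x.line :=
        (hxf.mem (Sum.inl ⟨0, hn₁⟩)).resolve_right (by simp_all)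
      have hcs := canServe_inl (n₂ := n₂) ⟨0, hn₁⟩ c
      generalize (Sum.inl ⟨0, hn₁⟩ : Server n₁ n₂) = v at hv hcs
      rcases hxf.exists_complete hv with ⟨P, R, I, rfl, hw⟩ | ⟨P, R₁, d, R₂, I, rfl, hw, hd⟩
      · have := hw (Sum.inr c) (by simpa using hc)
        simp [Config.isWaitingFor, hcs] at this
      · have hstep := Config.complete_of_waiting (R₂ := R₂) I hxf.notMem.1 hw hd
        obtain ⟨y, hy, hxy⟩ := ih ⟨⟨P ++ R₁ ++ Sum.inl v :: R₂, I⟩,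
          hstep ▸ hxf.complete hv⟩ hx (by
          simp only [List.length_append, List.length_cons] at hn ⊢
          omega)
        exact ⟨y, hy, .head (rate_complete_pos hlam₁ hlam₂ hμ₁ hμ₂ hv hstep) hxy⟩

theorem isFeasible_empty {l : List (Server n₁ n₂)} (hl : ∀ v, l.count v = 1) :
    (⟨[], l⟩ : Config n₁ n₂).IsFeasible := by
  rw [Config.isFeasible_iff]
  exact ⟨fun v => by rw [List.count_nil, hl v], .nil, by simp⟩

/-- With nobody waiting, each completion puts its server at the head of the idle list. Completing
the servers of `l` from last to first therefore produces exactly the order `l`, so the target is a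
single configuration. -/
theorem reaches_empty_of_no_queue (hlam₁ : 0 < lam₁) (hlam₂ : 0 < lam₂) (hμ₁ : 0 < μ₁)
    (hμ₂ : 0 < μ₂) {l : List (Server n₁ n₂)} (hl : ∀ v, l.count v = 1)
    (l₁ l₂ : List (Server n₁ n₂)) (hll : l₁ ++ l₂ = l) (x : Feasible n₁ n₂)
    (hx : x.1.idle = l₂) (hc : ∀ c, Sum.inr c ∉ x.1.line) :
    Relation.ReflTransGen (fun x y => 0 < rate lam₁ lam₂ μ₁ μ₂ x y) x
      ⟨⟨[], l⟩, isFeasible_empty hl⟩ := by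
  induction l₁ using List.reverseRecOn generalizing l₂ x with
  | nil =>
    obtain ⟨⟨L, I⟩, hxf⟩ := x
    obtain rfl : I = l₂ := hx
    obtain rfl : I = l := hll
    obtain rfl : L = [] := by
      refine List.eq_nil_iff_forall_not_mem.2 fun z hz => ?_
      cases z with
      | inr c => exact hc c hz
      | inl v =>
        have := ((Config.isFeasible_iff _ _).1 hxf).1 v
        rw [hl v] at this
        have h2 := List.count_pos_iff.2 hz
        omega
    exact .refl
  | append_singleton l₁ v ih =>
    obtain ⟨⟨L, I⟩, hxf⟩ := x
    obtain rfl : I = l₂ := hx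
    have hv : Sum.inl v ∈ L := by
      refine (hxf.mem v).resolve_right fun h => ?_
      have h1 := hl v
      have h2 := List.count_pos_iff.2 h
      rw [← hll] at h1
      simp only [List.count_append, List.count_cons_self] at h1
      omega
    obtain ⟨P, R, rfl⟩ := List.append_of_mem hv
    have hw : ∀ z ∈ P ++ R, Config.isWaitingFor v z = false := by
      intro z hz
      cases z with
      | inl u => rfl
      | inr c => exact absurd (by simpa using hz) (hc c)
    have hstep := Config.complete_of_not_waiting I hxf.notMem.1 hw
    refine .head (rate_complete_pos hlam₁ hlam₂ hμ₁ hμ₂ hv hstep)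
      (ih (v :: I) (by simpa using hll) ⟨_, hstep ▸ hxf.complete hv⟩ rfl fun c h => hc c ?_)
    simpa using h

theorem reaches_empty (hn₁ : 0 < n₁) (hlam₁ : 0 < lam₁) (hlam₂ : 0 < lam₂) (hμ₁ : 0 < μ₁)
    (hμ₂ : 0 < μ₂) {l : List (Server n₁ n₂)} (hl : ∀ v, l.count v = 1) (x : Feasible n₁ n₂) :
    Relation.ReflTransGen (fun x y => 0 < rate lam₁ lam₂ μ₁ μ₂ x y) x
      ⟨⟨[], l⟩, isFeasible_empty hl⟩ := by
  obtain ⟨y, hy, hxy⟩ := reaches_no_idle hlam₁ hlam₂ hμ₁ hμ₂ x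
  obtain ⟨w, ⟨hw, hw'⟩, hyw⟩ := reaches_no_queue hn₁ hlam₁ hlam₂ hμ₁ hμ₂ y hy
  exact (hxy.trans hyw).trans
    (reaches_empty_of_no_queue hlam₁ hlam₂ hμ₁ hμ₂ hl l [] (by simp) w hw hw')

theorem exists_list_count_eq_one : ∃ l : List (Server n₁ n₂), ∀ v, l.count v = 1 :=
  ⟨Finset.univ.toList, fun v =>
    List.count_eq_one_of_mem (Finset.nodup_toList _) (by simp)⟩

theorem stationary_unique (hn₁ : 0 < n₁) (hlam₁ : 0 < lam₁) (hlam₂ : 0 < lam₂) (hμ₁ : 0 < μ₁)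
    (hμ₂ : 0 < μ₂) {p p' : Feasible n₁ n₂ → ℝ}
    (hp : IsStationaryDistribution (rate lam₁ lam₂ μ₁ μ₂) p)
    (hp' : IsStationaryDistribution (rate lam₁ lam₂ μ₁ μ₂) p') : p = p' := by
  obtain ⟨l, hl⟩ := exists_list_count_eq_one (n₁ := n₁) (n₂ := n₂)
  exact IsStationaryDistribution.eq (rate_nonneg hlam₁ hlam₂ hμ₁ hμ₂) hasSum_rate
    (fun x => add_le_add_right (busyRate_le hμ₁ hμ₂ x) _) _
    (reaches_empty hn₁ hlam₁ hlam₂ hμ₁ hμ₂ hl) hp hp'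

end Rates

/-! ### Every configuration has exactly one state. -/

/-- The shape of a line: the types of the waiting customers are forgotten. -/
abbrev Shape (n₁ n₂ : ℕ) : Type := List (Server n₁ n₂ ⊕ Unit)

namespace Shape

/-- The busy servers of a shape. -/
def servers (sh : Shape n₁ n₂) : List (Server n₁ n₂) := sh.filterMap Sum.getLeft?

theorem servers_append (sh sh' : Shape n₁ n₂) :
    servers (sh ++ sh' : List _) = servers sh ++ servers sh' :=
  List.filterMap_append

theorem servers_map (L : List (Item n₁ n₂)) :
    servers (L.map (Sum.map id fun _ => ())) = busyServers L := by
  rw [servers, busyServers, List.filterMap_map]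
  congr 1
  funext z
  cases z <;> rfl

/-- A busy server followed by `q` waiting customers. -/
def block (b : Server n₁ n₂ × ℕ) : Shape n₁ n₂ :=
  Sum.inl b.1 :: List.replicate b.2 (Sum.inr ())

theorem servers_replicate (k : ℕ) :
    servers (List.replicate k (Sum.inr ()) : Shape n₁ n₂) = [] := by
  induction k with
  | zero => rfl
  | succ k ih =>
    rw [List.replicate_succ]
    exact ih

theorem servers_flatten (bs : List (Server n₁ n₂ × ℕ)) :
    servers (bs.map block).flatten = bs.map Prod.fst := by
  induction bs with
  | nil => rfl
  | cons b bs ih =>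
    rw [List.map_cons, List.flatten_cons, servers_append, ih, List.map_cons]
    change b.1 :: servers (List.replicate b.2 (Sum.inr ())) ++ _ = _
    rw [servers_replicate]
    rfl

/-- Splits a shape into an initial run of waiting customers and blocks. -/
def decode : Shape n₁ n₂ → ℕ × List (Server n₁ n₂ × ℕ)
  | [] => (0, [])
  | Sum.inl v :: sh => (0, (v, (decode sh).1) :: (decode sh).2)
  | Sum.inr _ :: sh => ((decode sh).1 + 1, (decode sh).2)

/-- This inversion yields existence of the state; the opposite one, `decode_flatten`, yields
uniqueness. -/
theorem encode_decode (sh : Shape n₁ n₂) :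
    List.replicate (decode sh).1 (Sum.inr ()) ++ ((decode sh).2.map block).flatten = sh := by
  induction sh with
  | nil => rfl
  | cons z sh ih =>
    cases z with
    | inl v =>
      rw [decode, List.map_cons, List.flatten_cons, block]
      simpa using ih
    | inr c =>
      rw [decode, List.replicate_succ, List.cons_append, ih]

theorem decode_replicate_append (k : ℕ) (sh : Shape n₁ n₂) :
    decode (List.replicate k (Sum.inr ()) ++ sh : List _) = ((decode sh).1 + k, (decode sh).2) := by
  induction k with
  | zero => rfl
  | succ k ih =>
    rw [List.replicate_succ, List.cons_append, decode, ih]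
    rfl

theorem decode_flatten (bs : List (Server n₁ n₂ × ℕ)) :
    decode (bs.map block).flatten = (0, bs) := by
  induction bs with
  | nil => rfl
  | cons b bs ih =>
    rw [List.map_cons, List.flatten_cons, block, List.cons_append, decode,
      decode_replicate_append, ih, zero_add]

end Shape

namespace State

/-- The servers in the order `S_1, …, S_n`. -/
def serverList (s : State n₁ n₂) : List (Server n₁ n₂) := List.ofFn s.perm

/-- The blocks of the line. -/
def blocks (s : State n₁ n₂) : List (Server n₁ n₂ × ℕ) :=
  List.ofFn fun j : Fin (n₁ + n₂ - s.i) => (s.busyServer j, s.q j)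

/-- The shape of the line. -/
def shape (s : State n₁ n₂) : Shape n₁ n₂ := (s.blocks.map Shape.block).flatten

/-- The idle servers. -/
def idleList (s : State n₁ n₂) : List (Server n₁ n₂) := s.serverList.drop (n₁ + n₂ - s.i)

theorem length_serverList (s : State n₁ n₂) : s.serverList.length = n₁ + n₂ :=
  List.length_ofFn

theorem length_idleList (s : State n₁ n₂) : s.idleList.length = s.i := by
  have := s.i_le
  rw [idleList, List.length_drop, length_serverList]
  omega

theorem isStateOf_iff {s : State n₁ n₂} {x : Config n₁ n₂} :
    s.IsStateOf x ↔ x.line.map (Sum.map id fun _ => ()) = s.shape ∧ x.idle = s.idleList := by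
  rw [IsStateOf, shape, blocks, List.map_ofFn]
  rfl

theorem ofFn_busyServer (s : State n₁ n₂) :
    List.ofFn s.busyServer = s.serverList.take (n₁ + n₂ - s.i) := by
  refine List.ext_getElem (by simp [length_serverList]) fun k h1 h2 => ?_
  simp [serverList, busyServer]

theorem map_fst_blocks (s : State n₁ n₂) :
    s.blocks.map Prod.fst = s.serverList.take (n₁ + n₂ - s.i) := by
  rw [← ofFn_busyServer, blocks, List.map_ofFn]
  rfl

theorem servers_shape (s : State n₁ n₂) :
    Shape.servers s.shape = s.serverList.take (n₁ + n₂ - s.i) := by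
  rw [shape, Shape.servers_flatten, map_fst_blocks]

theorem servers_append_idleList (s : State n₁ n₂) :
    Shape.servers s.shape ++ s.idleList = s.serverList := by
  rw [servers_shape, idleList, List.take_append_drop]

theorem count_serverList (s : State n₁ n₂) (v : Server n₁ n₂) : s.serverList.count v = 1 :=
  List.count_eq_one_of_mem (List.nodup_ofFn.2 s.perm.injective)
    (List.mem_ofFn.2 (s.perm.surjective v))

theorem ext_of_blocks {s t : State n₁ n₂} (hb : s.blocks = t.blocks)
    (hi : s.idleList = t.idleList) : s = t := by
  have h1 : s.serverList = t.serverList := by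
    rw [← servers_append_idleList, ← servers_append_idleList, shape, shape, hb, hi]
  have h2 : s.i = t.i := by rw [← length_idleList, ← length_idleList, hi]
  obtain ⟨perm, i, hile, q⟩ := s
  obtain ⟨perm', i', hile', q'⟩ := t
  obtain rfl : i = i' := h2
  obtain rfl : perm = perm' := Equiv.coe_fn_injective (List.ofFn_injective h1)
  have h3 := List.ofFn_injective hb
  obtain rfl : q = q' := funext fun j => congrArg Prod.snd (congrFun h3 j)
  rfl

theorem IsStateOf.unique {s t : State n₁ n₂} {x : Config n₁ n₂} (hs : s.IsStateOf x)
    (ht : t.IsStateOf x) : s = t := by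
  rw [isStateOf_iff] at hs ht
  refine ext_of_blocks ?_ (hs.2.symm.trans ht.2)
  have := congrArg Shape.decode (hs.1.symm.trans ht.1)
  rw [shape, shape, Shape.decode_flatten, Shape.decode_flatten] at this
  exact (Prod.mk.inj this).2

end State

theorem Config.IsFeasible.exists_state (hn₁ : 0 < n₁) {x : Config n₁ n₂} (h : x.IsFeasible) :
    ∃ s : State n₁ n₂, s.IsStateOf x := by
  obtain ⟨L, I⟩ := x
  set sh : Shape n₁ n₂ := L.map (Sum.map id fun _ => ()) with hsh
  set bs := (Shape.decode sh).2 with hbs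
  have henc : (bs.map Shape.block).flatten = sh := by
    -- States cannot record customers ahead of the first busy server; feasibility excludes them.
    have h0 : (Shape.decode sh).1 = 0 := by
      cases L with
      | nil => rfl
      | cons z L =>
        cases z with
        | inl v => rfl
        | inr c => exact absurd rfl (h.ne_cons hn₁ c L)
    simpa [h0] using Shape.encode_decode sh
  have hservers : bs.map Prod.fst = busyServers L := by
    rw [← Shape.servers_flatten, henc, hsh, Shape.servers_map]
  set l := bs.map Prod.fst ++ I with hl
  have hnodup : l.Nodup := by
    rw [hl, hservers]
    exact h.nodup
  have hmem : ∀ v, v ∈ l := by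
    intro v
    rw [hl, hservers, List.mem_append, mem_busyServers]
    exact h.mem v
  let e := hnodup.getEquivOfForallMemList l hmem
  have hlen : l.length = n₁ + n₂ := by
    have := Fintype.card_congr e
    simpa using this
  have hlen' : bs.length + I.length = n₁ + n₂ := by
    rw [← hlen, hl, List.length_append, List.length_map]
  have hk : n₁ + n₂ - I.length = bs.length := by omega
  let s : State n₁ n₂ :=
    { perm := (finCongr hlen.symm).trans e
      i := I.length
      i_le := by omega
      q := fun j => (bs[j.1]'(by omega)).2 }
  have hs : s.serverList = l := by
    refine List.ext_getElem (by rw [State.length_serverList, hlen]) fun k h1 h2 => ?_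
    simp [State.serverList, s, e]
  refine ⟨s, State.isStateOf_iff.2 ⟨?_, ?_⟩⟩
  · change sh = _
    rw [← henc, State.shape]
    congr 2
    refine List.ext_getElem ?_ fun k h1 h2 => ?_
    · rw [State.blocks, List.length_ofFn, ← hk]
    · have h3 : (State.busyServer s ⟨k, by change k < n₁ + n₂ - I.length; omega⟩) = bs[k].1 := by
        have h4 : k < s.serverList.length := by rw [hs, hlen]; omega
        have h5 : s.serverList[k] = bs[k].1 := by
          simp only [hs, hl]
          rw [List.getElem_append_left (by simpa using h1), List.getElem_map]
        rw [← h5]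
        simp [State.serverList, State.busyServer]
      simp only [State.blocks, List.getElem_ofFn]
      rw [h3]
  · change I = _
    rw [State.idleList, hs]
    change I = l.drop (n₁ + n₂ - I.length)
    rw [hk, hl, List.drop_left' (by simp)]

/-! ### Summing out the types of the waiting customers. -/

section Labelings

/-- The lines of a given shape that are feasible with idle servers `I`. -/
def labelings (I : List (Server n₁ n₂)) : Shape n₁ n₂ → Finset (List (Item n₁ n₂))
  | [] => {[]}
  | Sum.inl v :: sh => (labelings I sh).image (Sum.inl v :: ·)
  | Sum.inr _ :: sh =>
    ((Finset.univ : Finset Customer).filter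
      fun c => ∀ u ∈ Shape.servers sh ++ I, canServe u c = false).biUnion
      fun c => (labelings I sh).image (Sum.inr c :: ·)

theorem mem_labelings {I : List (Server n₁ n₂)} {sh : Shape n₁ n₂} {L : List (Item n₁ n₂)} :
    L ∈ labelings I sh ↔ L.map (Sum.map id fun _ => ()) = sh ∧ L.Pairwise Skips ∧
      ∀ c, Sum.inr c ∈ L → ∀ v ∈ I, canServe v c = false := by
  induction sh generalizing L with
  | nil =>
    rw [labelings, Finset.mem_singleton]
    constructor
    · rintro rfl
      simp
    · rintro ⟨h, -⟩
      simpa using h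
  | cons z sh ih =>
    cases z with
    | inl v =>
      rw [labelings, Finset.mem_image]
      constructor
      · rintro ⟨L, hL, rfl⟩
        obtain ⟨h1, h2, h3⟩ := ih.1 hL
        refine ⟨by simp [h1], List.pairwise_cons.2 ⟨fun b _ => Skips.inl_left v b, h2⟩, ?_⟩
        intro c hc
        exact h3 c (by simpa using hc)
      · rintro ⟨h1, h2, h3⟩
        cases L with
        | nil => simp at h1
        | cons a L =>
          rw [List.map_cons, List.cons.injEq] at h1
          cases a with
          | inr c => simp at h1
          | inl u =>
            obtain rfl : u = v := by simpa using h1.1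
            exact ⟨L, ih.2 ⟨h1.2, (List.pairwise_cons.1 h2).2, fun c hc => h3 c (by simp [hc])⟩,
              rfl⟩
    | inr w =>
      simp only [labelings, Finset.mem_biUnion, Finset.mem_filter, Finset.mem_univ, true_and,
        Finset.mem_image]
      constructor
      · rintro ⟨c, hc, L, hL, rfl⟩
        obtain ⟨h1, h2, h3⟩ := ih.1 hL
        refine ⟨by simp [h1], List.pairwise_cons.2 ⟨?_, h2⟩, ?_⟩
        · rintro b hb d u hd rfl
          obtain rfl := Sum.inr_injective hd
          refine hc u (List.mem_append.2 (Or.inl ?_))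
          rw [← h1, Shape.servers_map, mem_busyServers]
          exact hb
        · intro d hd u hu
          rcases List.mem_cons.1 hd with hd | hd
          · obtain rfl := Sum.inr_injective hd
            exact hc u (List.mem_append.2 (Or.inr hu))
          · exact h3 d hd u hu
      · rintro ⟨h1, h2, h3⟩
        cases L with
        | nil => simp at h1
        | cons a L =>
          rw [List.map_cons, List.cons.injEq] at h1
          cases a with
          | inl u => simp at h1
          | inr c =>
            refine ⟨c, ?_, L, ih.2 ⟨h1.2, (List.pairwise_cons.1 h2).2,
              fun c hc => h3 c (by simp [hc])⟩, rfl⟩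
            intro u hu
            rcases List.mem_append.1 hu with hu | hu
            · rw [← h1.2, Shape.servers_map, mem_busyServers] at hu
              exact (List.pairwise_cons.1 h2).1 _ hu c u rfl rfl
            · exact h3 c (by simp) u hu

/-- The total arrival rate of the customers that no server in `l` can serve. -/
noncomputable def unservedRate (lam : Customer → ℝ) (l : List (Server n₁ n₂)) : ℝ :=
  ∑ c, if ∀ u ∈ l, canServe u c = false then lam c else 0

/-- The total weight of the labelings of a shape that follows busy servers of total rate `m`. -/
noncomputable def shapeWeight (lam : Customer → ℝ) (mu : Server n₁ n₂ → ℝ)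
    (I : List (Server n₁ n₂)) : ℝ → Shape n₁ n₂ → ℝ
  | _, [] => 1
  | m, Sum.inl v :: sh => (m + mu v)⁻¹ * shapeWeight lam mu I (m + mu v) sh
  | m, Sum.inr _ :: sh => unservedRate lam (Shape.servers sh ++ I) / m * shapeWeight lam mu I m sh

variable {lam : Customer → ℝ} {mu : Server n₁ n₂ → ℝ}

/-- The types allowed for a waiting customer depend only on the servers behind him, and he does not
change `m`; so the types are summed independently. -/
theorem sum_labelings (I : List (Server n₁ n₂)) (sh : Shape n₁ n₂) (m : ℝ) :
    ∑ L ∈ labelings I sh, lineWeight lam mu m L = shapeWeight lam mu I m sh := by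
  induction sh generalizing m with
  | nil => simp [labelings, lineWeight, shapeWeight]
  | cons z sh ih =>
    cases z with
    | inl v =>
      rw [labelings, Finset.sum_image fun L _ L' _ h => (List.cons.inj h).2]
      simp only [lineWeight, shapeWeight, ← Finset.mul_sum, ih]
    | inr w =>
      rw [labelings, Finset.sum_biUnion]
      · have h1 : ∀ c, ∑ L ∈ (labelings I sh).image (Sum.inr c :: ·), lineWeight lam mu m L =
            lam c * (shapeWeight lam mu I m sh / m) := by
          intro c
          rw [Finset.sum_image fun L _ L' _ h => (List.cons.inj h).2]
          simp only [lineWeight, ← Finset.mul_sum, ih]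
          ring
        simp only [h1, ← Finset.sum_mul, Finset.sum_filter]
        rw [shapeWeight, unservedRate]
        ring
      · intro c _ c' _ hcc
        rw [Function.onFun, Finset.disjoint_left]
        intro L hL hL'
        obtain ⟨A, -, rfl⟩ := Finset.mem_image.1 hL
        obtain ⟨B, -, hB⟩ := Finset.mem_image.1 hL'
        exact hcc (Sum.inr_injective (List.cons.inj hB).1).symm

theorem shapeWeight_replicate_append (I : List (Server n₁ n₂)) (k : ℕ) (sh : Shape n₁ n₂) (m : ℝ) :
    shapeWeight lam mu I m (List.replicate k (Sum.inr ()) ++ sh : List _) =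
      (unservedRate lam (Shape.servers sh ++ I) / m) ^ k * shapeWeight lam mu I m sh := by
  induction k with
  | zero => simp
  | succ k ih =>
    rw [List.replicate_succ, List.cons_append, shapeWeight, ih, Shape.servers_append,
      Shape.servers_replicate, List.nil_append, pow_succ']
    ring

/-- The server of block `j` and its `q j` customers all divide by the same partial rate, hence the
exponent `q j + 1`. -/
theorem shapeWeight_flatten (I : List (Server n₁ n₂)) {k : ℕ} (f : Fin k → Server n₁ n₂)
    (q : Fin k → ℕ) (m : ℝ) :
    shapeWeight lam mu I m ((List.ofFn fun j => (f j, q j)).map Shape.block).flatten =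
      ∏ j : Fin k, unservedRate lam ((List.ofFn f).drop (j + 1) ++ I) ^ q j /
        (m + (((List.ofFn f).take (j + 1)).map mu).sum) ^ (q j + 1) := by
  induction k generalizing m with
  | zero => simp [shapeWeight]
  | succ k ih =>
    rw [List.ofFn_succ, List.map_cons, List.flatten_cons, Shape.block, List.cons_append, shapeWeight,
      shapeWeight_replicate_append, ih, Fin.prod_univ_succ, Shape.servers_flatten, List.map_ofFn,
      List.ofFn_succ]
    simp only [Fin.val_zero, Fin.val_succ, List.drop_succ_cons, List.take_succ_cons,
      List.map_cons, List.sum_cons, List.drop_zero, List.take_zero, List.map_nil, List.sum_nil,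
      add_zero, add_assoc]
    rw [← mul_assoc]
    congr 1
    rw [div_pow, pow_succ, inv_mul_eq_div, div_div]
    rfl

theorem idleWeight_eq_prod (l : List (Server n₁ n₂)) :
    idleWeight lam l = ∏ k ∈ Finset.range l.length, (servedRate lam (l.drop k))⁻¹ := by
  induction l with
  | nil => rfl
  | cons v l ih =>
    rw [idleWeight, List.length_cons, Finset.prod_range_succ', mul_comm, ih]
    simp

end Labelings

namespace State

variable {lam : Customer → ℝ} {mu : Server n₁ n₂ → ℝ}

theorem isFeasible_of_mem_labelings (s : State n₁ n₂) {L : List (Item n₁ n₂)}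
    (h : L ∈ labelings s.idleList s.shape) : (⟨L, s.idleList⟩ : Config n₁ n₂).IsFeasible := by
  obtain ⟨h1, h2, h3⟩ := mem_labelings.1 h
  refine (Config.isFeasible_iff _ _).2 ⟨fun v => ?_, h2, h3⟩
  rw [← count_busyServers, ← Shape.servers_map, h1, ← List.count_append, servers_append_idleList,
    count_serverList]

/-- The total weight of the configurations with state `s`. -/
noncomputable def totalWeight (lam : Customer → ℝ) (mu : Server n₁ n₂ → ℝ) (s : State n₁ n₂) : ℝ :=
  shapeWeight lam mu s.idleList 0 s.shape * idleWeight lam s.idleList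

theorem hasSum_weight (s : State n₁ n₂) :
    HasSum (fun x : {x : Feasible n₁ n₂ // s.IsStateOf x.1} => x.1.1.weight lam mu)
      (s.totalWeight lam mu) := by
  let g : labelings s.idleList s.shape → {x : Feasible n₁ n₂ // s.IsStateOf x.1} := fun L =>
    ⟨⟨⟨L.1, s.idleList⟩, s.isFeasible_of_mem_labelings L.2⟩,
      isStateOf_iff.2 ⟨(mem_labelings.1 L.2).1, rfl⟩⟩
  have hg : Function.Bijective g := by
    constructor
    · intro L L' h
      have := congrArg (fun x => x.1.1.line) h
      exact Subtype.ext this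
    · rintro ⟨⟨⟨L, I⟩, hx⟩, hs⟩
      obtain ⟨h1, h2⟩ := isStateOf_iff.1 hs
      simp only at h1 h2
      subst h2
      obtain ⟨-, h3, h4⟩ := (Config.isFeasible_iff _ _).1 hx
      exact ⟨⟨L, mem_labelings.2 ⟨h1, h3, h4⟩⟩, rfl⟩
  rw [← (Equiv.ofBijective g hg).hasSum_iff, totalWeight, ← sum_labelings, Finset.sum_mul,
    ← Finset.sum_coe_sort]
  exact hasSum_fintype _

end State

/-! ### Evaluation of the product for the N-system. -/

namespace State

variable {lam₁ lam₂ μ₁ μ₂ : ℝ}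

theorem mem_drop_serverList {s : State n₁ n₂} {l : ℕ} {u : Server n₁ n₂} :
    u ∈ s.serverList.drop l ↔ ∃ j : Fin (n₁ + n₂), l ≤ j.val ∧ s.perm j = u := by
  rw [List.mem_drop_iff_getElem]
  constructor
  · rintro ⟨k, hk, rfl⟩
    rw [length_serverList] at hk
    exact ⟨⟨l + k, by omega⟩, by simp, by simp [serverList]⟩
  · rintro ⟨j, hj, rfl⟩
    refine ⟨j - l, by rw [length_serverList]; omega, ?_⟩
    have : l + (j.val - l) = j.val := by omega
    simp [serverList, this]

theorem card_filter_not_lt (n l : ℕ) :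
    (Finset.univ.filter fun j : Fin n => ¬ j.val < l).card = n - l := by
  have h := Finset.card_filter_add_card_filter_not (s := (Finset.univ : Finset (Fin n)))
    fun j => j.val < l
  rw [Fin.card_filter_val_lt, Finset.card_univ, Fintype.card_fin] at h
  omega

theorem prod_Icc_one_eq_prod_fin (m : ℕ) (g : ℕ → ℝ) :
    ∏ l ∈ Finset.Icc 1 m, g l = ∏ j : Fin m, g (j + 1) := by
  rw [show Finset.Icc 1 m = Finset.Ico (0 + 1) (m + 1) from rfl, ← Finset.prod_Ico_add' _ 0 m 1,
    ← Finset.range_eq_Ico, Finset.prod_range]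

/-- The set of places counted by `K` is upward closed, so its cardinality determines it; it is
compared with `Finset.Ici j` and `Finset.Ioi j`. -/
theorem forall_isRight_iff_of_fin (s : State n₁ n₂) (j : Fin (n₁ + n₂)) :
    (∀ j' : Fin (n₁ + n₂), j ≤ j' → (s.perm j').isRight = true) ↔ n₁ + n₂ - s.K ≤ j.val := by
  constructor
  · intro h
    have h1 : (Finset.Ici j).card ≤ s.K := by
      refine Finset.card_le_card fun a ha => ?_
      simp only [Finset.mem_filter, Finset.mem_univ, true_and]
      exact fun j' hj' => h j' ((Finset.mem_Ici.1 ha).trans hj')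
    rw [Fin.card_Ici] at h1
    omega
  · intro h
    by_contra hj
    have h1 : s.K ≤ (Finset.Ioi j).card := by
      refine Finset.card_le_card fun a ha => ?_
      simp only [Finset.mem_filter, Finset.mem_univ, true_and] at ha
      refine Finset.mem_Ioi.2 (lt_of_not_ge fun haj => hj fun j' hj' => ha j' (haj.trans hj'))
    rw [Fin.card_Ioi] at h1
    have := j.isLt
    omega

theorem forall_isRight_iff (s : State n₁ n₂) {l : ℕ} (hl : l ≤ n₁ + n₂) :
    (∀ u ∈ s.serverList.drop l, u.isRight = true) ↔ n₁ + n₂ - s.K ≤ l := by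
  rcases hl.lt_or_eq with hl | rfl
  · rw [← s.forall_isRight_iff_of_fin ⟨l, hl⟩]
    constructor
    · exact fun h j' hj' => h _ (mem_drop_serverList.2 ⟨j', hj', rfl⟩)
    · intro h u hu
      obtain ⟨j, hj, rfl⟩ := mem_drop_serverList.1 hu
      exact h j hj
  · simp [List.drop_of_length_le (length_serverList s).le]

theorem K_lt (hn₁ : 0 < n₁) (s : State n₁ n₂) : s.K < n₁ + n₂ := by
  by_contra h
  have := (s.forall_isRight_iff (Nat.zero_le _)).2 (by omega) (Sum.inl ⟨0, hn₁⟩)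
    (mem_drop_serverList.2 ⟨s.perm.symm _, Nat.zero_le _, s.perm.apply_symm_apply _⟩)
  simp at this

theorem canServe_c2_eq_false {v : Server n₁ n₂} :
    canServe v Customer.c2 = false ↔ v.isRight = true := by
  cases v <;> simp [canServe]

theorem unservedRate_drop (s : State n₁ n₂) {l : ℕ} (hl : l ≤ n₁ + n₂) :
    unservedRate (arrivalRate lam₁ lam₂) (s.serverList.drop l) =
      (if l = n₁ + n₂ then lam₁ else 0) + if n₁ + n₂ - s.K ≤ l then lam₂ else 0 := by
  rw [unservedRate, Customer.sum_univ]
  congr 1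
  · refine if_congr ?_ rfl rfl
    simp only [canServe_c1, Bool.true_eq_false, imp_false]
    rw [← List.eq_nil_iff_forall_not_mem, List.drop_eq_nil_iff, length_serverList]
    omega
  · refine if_congr ?_ rfl rfl
    rw [← s.forall_isRight_iff hl]
    simp only [canServe_c2_eq_false]

theorem servedRate_drop (s : State n₁ n₂) {l : ℕ} (hl : l < n₁ + n₂) :
    servedRate (arrivalRate lam₁ lam₂) (s.serverList.drop l) =
      lam₁ + if l < n₁ + n₂ - s.K then lam₂ else 0 := by
  rw [servedRate, Customer.sum_univ]
  congr 1
  · exact if_pos ⟨s.perm ⟨l, hl⟩, mem_drop_serverList.2 ⟨_, le_rfl, rfl⟩, canServe_c1 _⟩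
  · refine if_congr ?_ rfl rfl
    rw [← not_le, ← s.forall_isRight_iff hl.le]
    simp only [← canServe_c2_eq_false]
    push Not
    simp

theorem sum_take_serverList (s : State n₁ n₂) (l : ℕ) :
    ((s.serverList.take l).map (serviceRate μ₁ μ₂)).sum = s.partialRate μ₁ μ₂ l := by
  rw [serverList, List.map_take, List.map_ofFn, List.sum_take_ofFn, partialRate]
  rfl

theorem partialRate_pos (hμ₁ : 0 < μ₁) (hμ₂ : 0 < μ₂) (s : State n₁ n₂) {l : ℕ} (hl : 0 < l)
    (hl' : l ≤ n₁ + n₂) : 0 < s.partialRate μ₁ μ₂ l :=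
  Finset.sum_pos (fun _ _ => serviceRate_pos hμ₁ hμ₂ _)
    ⟨⟨0, by omega⟩, by simpa using hl⟩

/-- All servers after place `l` have type `s₂`; their rates are subtracted from the total. -/
theorem partialRate_eq (s : State n₁ n₂) {l : ℕ} (hl : l ≤ n₁ + n₂) (hK : n₁ + n₂ - s.K ≤ l) :
    s.partialRate μ₁ μ₂ l = μ₁ * n₁ + μ₂ * ((l : ℝ) - n₁) := by
  have h1 : ∑ j, serviceRate μ₁ μ₂ (s.perm j) = n₁ * μ₁ + n₂ * μ₂ := by
    rw [s.perm.sum_comp (serviceRate μ₁ μ₂), Fintype.sum_sum_type]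
    simp [serviceRate]
  have h2 : ∑ j : Fin (n₁ + n₂) with ¬ j.val < l, serviceRate μ₁ μ₂ (s.perm j) =
      ((n₁ + n₂ : ℕ) - l : ℝ) * μ₂ := by
    have h3 : ∀ j ∈ Finset.univ.filter (fun j : Fin (n₁ + n₂) => ¬ j.val < l),
        serviceRate μ₁ μ₂ (s.perm j) = μ₂ := by
      intro j hj
      simp only [Finset.mem_filter, Finset.mem_univ, true_and, not_lt] at hj
      have h4 := (s.forall_isRight_iff hl).2 hK _ (mem_drop_serverList.2 ⟨j, hj, rfl⟩)
      cases h5 : s.perm j with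
      | inl a => simp [h5] at h4
      | inr b => rfl
    rw [Finset.sum_congr rfl h3, Finset.sum_const, nsmul_eq_mul, card_filter_not_lt,
      Nat.cast_sub hl]
  have h6 := Finset.sum_filter_add_sum_filter_not Finset.univ
    (fun j : Fin (n₁ + n₂) => j.val < l) fun j => serviceRate μ₁ μ₂ (s.perm j)
  rw [h1, h2] at h6
  rw [partialRate]
  push_cast at h6
  linarith

theorem queue_succ (s : State n₁ n₂) (j : Fin (n₁ + n₂ - s.i)) : s.queue (j + 1) = s.q j := by
  rw [queue, dif_pos (by simp)]
  rfl

/-- The arrival rate of the customers who can be waiting right after `S_l`. -/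
noncomputable def waitRate (lam₁ lam₂ : ℝ) (s : State n₁ n₂) (l : ℕ) : ℝ :=
  (if l = n₁ + n₂ then lam₁ else 0) + if n₁ + n₂ - s.K ≤ l then lam₂ else 0

theorem totalWeight_eq (s : State n₁ n₂) :
    s.totalWeight (arrivalRate lam₁ lam₂) (serviceRate μ₁ μ₂) =
      (∏ l ∈ Finset.Icc 1 (n₁ + n₂ - s.i),
        s.waitRate lam₁ lam₂ l ^ s.queue l / s.partialRate μ₁ μ₂ l ^ (s.queue l + 1)) *
      ∏ l ∈ Finset.Ico (n₁ + n₂ - s.i) (n₁ + n₂),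
        (lam₁ + if l < n₁ + n₂ - s.K then lam₂ else 0)⁻¹ := by
  rw [totalWeight, shape, blocks, shapeWeight_flatten, idleWeight_eq_prod, ofFn_busyServer]
  congr 1
  · rw [prod_Icc_one_eq_prod_fin]
    refine Finset.prod_congr rfl fun j _ => ?_
    have hj : j.val + 1 ≤ n₁ + n₂ - s.i := j.isLt
    have h1 : (s.serverList.take (n₁ + n₂ - s.i)).drop (j + 1) ++ s.idleList =
        s.serverList.drop (j + 1) := by
      rw [idleList, ← List.drop_append_of_le_length, List.take_append_drop]
      rw [List.length_take, length_serverList]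
      omega
    rw [h1, List.take_take, min_eq_left hj, sum_take_serverList, zero_add,
      unservedRate_drop s (by omega), queue_succ]
    rfl
  · rw [length_idleList]
    have h1 : n₁ + n₂ = s.i + (n₁ + n₂ - s.i) := by
      have := s.i_le
      omega
    have h2 : Finset.Ico (n₁ + n₂ - s.i) (n₁ + n₂) =
        Finset.Ico (0 + (n₁ + n₂ - s.i)) (s.i + (n₁ + n₂ - s.i)) := by
      rw [← h1, zero_add]
    rw [h2, ← Finset.prod_Ico_add' _ 0 s.i, ← Finset.range_eq_Ico]
    refine Finset.prod_congr rfl fun k hk => ?_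
    have hk' := Finset.mem_range.1 hk
    rw [idleList, List.drop_drop, add_comm (n₁ + n₂ - s.i) k, servedRate_drop s (by omega)]

theorem I₁_add_I₂ (s : State n₁ n₂) : s.I₁ + s.I₂ = s.i := by
  have h1 : s.I₁ + s.I₂ =
      (Finset.univ.filter fun j : Fin (n₁ + n₂) => ¬ j.val < n₁ + n₂ - s.i).card := by
    rw [I₁, I₂, ← Finset.card_union_of_disjoint]
    · congr 1
      ext j
      simp only [Finset.mem_union, Finset.mem_filter, Finset.mem_univ, true_and, not_lt]
      cases s.perm j <;> simp
    · rw [Finset.disjoint_left]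
      intro j hj hj'
      simp only [Finset.mem_filter, Finset.mem_univ, true_and] at hj hj'
      cases h : s.perm j <;> simp [h] at hj hj'
  rw [h1, card_filter_not_lt]
  have := s.i_le
  omega

/-- The last server of type `s₁` has place `n - K`, and it is idle exactly when this place lies
beyond the busy ones. -/
theorem I₁_pos_iff (s : State n₁ n₂) : 0 < s.I₁ ↔ n₁ + n₂ - s.i < n₁ + n₂ - s.K := by
  rw [← not_iff_not, not_lt, not_lt, ← s.forall_isRight_iff (Nat.sub_le _ _), Nat.le_zero,
    I₁, Finset.card_eq_zero, Finset.filter_eq_empty_iff]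
  constructor
  · intro h u hu
    obtain ⟨j, hj, rfl⟩ := mem_drop_serverList.1 hu
    have := h (Finset.mem_univ j)
    cases hp : s.perm j <;> simp_all
  · rintro h j - ⟨hj, hl⟩
    have := h _ (mem_drop_serverList.2 ⟨j, hj, rfl⟩)
    cases hp : s.perm j <;> simp_all

theorem totalWeight_of_not_isAdmissible (s : State n₁ n₂) (h : ¬ s.IsAdmissible) :
    s.totalWeight (arrivalRate lam₁ lam₂) (serviceRate μ₁ μ₂) = 0 := by
  rw [IsAdmissible] at h
  push Not at h
  obtain ⟨j, hj1, hjK, hji, hq⟩ := h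
  rw [totalWeight_eq]
  refine mul_eq_zero_of_left (Finset.prod_eq_zero (Finset.mem_Icc.2 ⟨hj1, hji⟩) ?_) _
  rw [waitRate, if_neg (by omega), if_neg (by omega), add_zero, zero_pow hq, zero_div]

/-- Both products change form at `n - K`. This place lies among the idle servers if `I₁` is positive
and among the busy ones otherwise; with no idle servers, the factor `l = n` splits off because both
types can wait there. -/
theorem totalWeight_of_isAdmissible (hn₁ : 0 < n₁) (s : State n₁ n₂) (h : s.IsAdmissible) :
    s.totalWeight (arrivalRate lam₁ lam₂) (serviceRate μ₁ μ₂) = s.weight lam₁ lam₂ μ₁ μ₂ := by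
  have hK := s.K_lt hn₁
  have hi := s.i_le
  have hI := s.I₁_add_I₂
  have hI₁ := s.I₁_pos_iff
  have hlow : ∀ l, 1 ≤ l → l < n₁ + n₂ - s.K → l ≤ n₁ + n₂ - s.i →
      s.waitRate lam₁ lam₂ l ^ s.queue l / s.partialRate μ₁ μ₂ l ^ (s.queue l + 1) =
        (s.partialRate μ₁ μ₂ l)⁻¹ := by
    intro l h1 h2 h3
    rw [h l h1 h2 h3, pow_zero, zero_add, pow_one, one_div]
  have hhigh : ∀ l, n₁ + n₂ - s.K ≤ l → l < n₁ + n₂ →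
      s.waitRate lam₁ lam₂ l ^ s.queue l / s.partialRate μ₁ μ₂ l ^ (s.queue l + 1) =
        lam₂ ^ s.queue l / (μ₁ * n₁ + μ₂ * ((l : ℝ) - n₁)) ^ (s.queue l + 1) := by
    intro l h1 h2
    rw [waitRate, if_neg h2.ne, if_pos h1, zero_add, partialRate_eq s h2.le h1]
  rw [totalWeight_eq, weight]
  split_ifs with h1 h2
  · have hr := hI₁.1 h1
    have e1 : n₁ + n₂ - s.I₁ - s.I₂ = n₁ + n₂ - s.i := by omega
    have e2 : s.I₁ + s.I₂ - s.K = n₁ + n₂ - s.K - (n₁ + n₂ - s.i) := by omega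
    have e3 : s.K = n₁ + n₂ - (n₁ + n₂ - s.K) := by omega
    rw [e1, mul_assoc]
    congr 1
    · refine Finset.prod_congr rfl fun l hl => ?_
      obtain ⟨hl1, hl2⟩ := Finset.mem_Icc.1 hl
      exact hlow l hl1 (by omega) hl2
    · rw [← Finset.prod_Ico_consecutive _ hr.le (Nat.sub_le _ s.K)]
      congr 1
      · rw [e2, Finset.prod_congr rfl fun l hl => by rw [if_pos (Finset.mem_Ico.1 hl).2],
          Finset.prod_const, Nat.card_Ico, one_div]
      · rw [Finset.prod_congr rfl fun l hl => by
          rw [if_neg (not_lt.2 (Finset.mem_Ico.1 hl).1), add_zero],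
          Finset.prod_const, Nat.card_Ico, one_div, ← e3]
  · have hr : n₁ + n₂ - s.K ≤ n₁ + n₂ - s.i := not_lt.1 (mt hI₁.2 h1)
    have e1 : s.I₂ = s.i := by omega
    rw [e1]
    congr 1
    · have e2 : Finset.Icc 1 (n₁ + n₂ - s.i) = Finset.Ico 1 (n₁ + n₂ - s.i + 1) := rfl
      have e3 : Finset.Icc 1 (n₁ + n₂ - s.K - 1) = Finset.Ico 1 (n₁ + n₂ - s.K) := by
        ext l
        simp only [Finset.mem_Icc, Finset.mem_Ico]
        omega
      rw [e2, e3, ← Finset.prod_Ico_consecutive _ (show 1 ≤ n₁ + n₂ - s.K by omega)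
        (show n₁ + n₂ - s.K ≤ n₁ + n₂ - s.i + 1 by omega)]
      congr 1
      · refine Finset.prod_congr rfl fun l hl => ?_
        obtain ⟨hl1, hl2⟩ := Finset.mem_Ico.1 hl
        exact hlow l hl1 hl2 (by omega)
      · refine Finset.prod_congr rfl fun l hl => ?_
        obtain ⟨hl1, hl2⟩ := Finset.mem_Ico.1 hl
        exact hhigh l hl1 (by omega)
    · rw [Finset.prod_congr rfl fun l hl => by
          rw [if_neg (not_lt.2 (hr.trans (Finset.mem_Ico.1 hl).1)), add_zero],
          Finset.prod_const, Nat.card_Ico, one_div]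
      congr 1
      omega
  · have e1 : s.i = 0 := by omega
    rw [e1, Nat.sub_zero, Finset.Ico_self, Finset.prod_empty, mul_one]
    have e2 : Finset.Icc 1 (n₁ + n₂) = Finset.Ico 1 (n₁ + n₂ + 1) := rfl
    have e3 : Finset.Icc 1 (n₁ + n₂ - s.K - 1) = Finset.Ico 1 (n₁ + n₂ - s.K) := by
      ext l
      simp only [Finset.mem_Icc, Finset.mem_Ico]
      omega
    have e4 : Finset.Icc (n₁ + n₂ - s.K) (n₁ + n₂ - 1) =
        Finset.Ico (n₁ + n₂ - s.K) (n₁ + n₂) := by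
      ext l
      simp only [Finset.mem_Icc, Finset.mem_Ico]
      omega
    rw [e2, e3, e4, Finset.prod_Ico_succ_top (by omega),
      ← Finset.prod_Ico_consecutive _ (show 1 ≤ n₁ + n₂ - s.K by omega) (Nat.sub_le _ s.K)]
    congr 1
    · congr 1
      · refine Finset.prod_congr rfl fun l hl => ?_
        obtain ⟨hl1, hl2⟩ := Finset.mem_Ico.1 hl
        exact hlow l hl1 hl2 (by omega)
      · refine Finset.prod_congr rfl fun l hl => ?_
        obtain ⟨hl1, hl2⟩ := Finset.mem_Ico.1 hl
        exact hhigh l hl1 hl2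
    · rw [waitRate, if_pos rfl, if_pos (Nat.sub_le _ _), partialRate_eq s le_rfl (Nat.sub_le _ _)]
      push_cast
      ring

theorem mul_totalWeight (hn₁ : 0 < n₁) (B : ℝ) (s : State n₁ n₂) :
    B * s.totalWeight (arrivalRate lam₁ lam₂) (serviceRate μ₁ μ₂) =
      s.productForm lam₁ lam₂ μ₁ μ₂ B := by
  rw [productForm]
  split_ifs with h
  · rw [totalWeight_of_isAdmissible hn₁ s h]
  · rw [totalWeight_of_not_isAdmissible s h, mul_zero]

end State

/-! ### Summability and normalization. -/

variable {lam₁ lam₂ μ₁ μ₂ : ℝ}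

theorem Config.weight_nonneg (hlam₁ : 0 < lam₁) (hlam₂ : 0 < lam₂) (hμ₁ : 0 < μ₁) (hμ₂ : 0 < μ₂)
    (x : Config n₁ n₂) : 0 ≤ x.weight (arrivalRate lam₁ lam₂) (serviceRate μ₁ μ₂) :=
  mul_nonneg (lineWeight_nonneg (arrivalRate_pos hlam₁ hlam₂) (serviceRate_pos hμ₁ hμ₂) le_rfl _)
    (idleWeight_pos (arrivalRate_pos hlam₁ hlam₂) _).le

theorem summable_prod_geometric {r : ℝ} (hr : 0 ≤ r) (hr' : r < 1) (k : ℕ) :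
    Summable fun q : Fin k → ℕ => ∏ j, r ^ q j := by
  induction k with
  | zero => exact (hasSum_fintype _).summable
  | succ k ih =>
    rw [← (Fin.consEquiv fun _ : Fin (k + 1) => ℕ).summable_iff]
    have h := (summable_geometric_of_lt_one hr hr').mul_of_nonneg ih
      (fun m => pow_nonneg hr m) (fun q => Finset.prod_nonneg fun j _ => pow_nonneg hr _)
    refine h.congr fun a => ?_
    simp [Fin.prod_univ_succ, Fin.consEquiv]

namespace State

theorem waitRate_nonneg (hlam₁ : 0 < lam₁) (hlam₂ : 0 < lam₂) (s : State n₁ n₂) (l : ℕ) :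
    0 ≤ s.waitRate lam₁ lam₂ l := by
  unfold waitRate
  split_ifs <;> positivity

theorem totalWeight_nonneg (hlam₁ : 0 < lam₁) (hlam₂ : 0 < lam₂) (hμ₁ : 0 < μ₁) (hμ₂ : 0 < μ₂)
    (s : State n₁ n₂) : 0 ≤ s.totalWeight (arrivalRate lam₁ lam₂) (serviceRate μ₁ μ₂) :=
  s.hasSum_weight.nonneg fun x => x.1.1.weight_nonneg hlam₁ hlam₂ hμ₁ hμ₂

/-- The ratio equals the first load at `l = n`. From `n - K` up to `n - 1` it is at most the second
load, since all `n₁` flexible servers are already counted; before that it is 0. -/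
theorem waitRate_div_le (hn₁ : 0 < n₁) (hlam₂ : 0 < lam₂) (hμ₁ : 0 < μ₁)
    (hμ₂ : 0 < μ₂) (s : State n₁ n₂) {l : ℕ} (hl : l ≤ n₁ + n₂) :
    s.waitRate lam₁ lam₂ l / s.partialRate μ₁ μ₂ l ≤
      max ((lam₁ + lam₂) / (n₁ * μ₁ + n₂ * μ₂)) (lam₂ / (n₁ * μ₁)) := by
  have hn : (0 : ℝ) < n₁ := by exact_mod_cast hn₁
  by_cases h1 : n₁ + n₂ - s.K ≤ l
  · rw [partialRate_eq s hl h1]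
    rcases hl.lt_or_eq with h2 | rfl
    · refine le_max_of_le_right ?_
      rw [waitRate, if_neg h2.ne, if_pos h1, zero_add]
      have h3 : n₁ ≤ l := by
        have hK : s.K ≤ n₂ := by
          have h4 : s.K ≤ (Finset.univ.image fun b : Fin n₂ => s.perm.symm (Sum.inr b)).card := by
            refine Finset.card_le_card fun j hj => ?_
            simp only [Finset.mem_filter, Finset.mem_univ, true_and] at hj
            have h5 := hj j le_rfl
            cases h6 : s.perm j with
            | inl a => simp [h6] at h5
            | inr b => exact Finset.mem_image.2 ⟨b, by simp, by rw [← h6, Equiv.symm_apply_apply]⟩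
          exact h4.trans (Finset.card_image_le.trans (by simp))
        omega
      have h3' : (n₁ : ℝ) ≤ l := by exact_mod_cast h3
      refine div_le_div_of_nonneg_left hlam₂.le (by positivity) ?_
      nlinarith [mul_nonneg hμ₂.le (sub_nonneg.2 h3')]
    · refine le_max_of_le_left (le_of_eq ?_)
      rw [waitRate, if_pos rfl, if_pos h1]
      push_cast
      ring
  · rw [waitRate, if_neg (by omega), if_neg h1, add_zero, zero_div]
    exact le_max_of_le_right (by positivity)

theorem totalWeight_le (hn₁ : 0 < n₁) (hlam₁ : 0 < lam₁) (hlam₂ : 0 < lam₂) (hμ₁ : 0 < μ₁)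
    (hμ₂ : 0 < μ₂) (s : State n₁ n₂) :
    s.totalWeight (arrivalRate lam₁ lam₂) (serviceRate μ₁ μ₂) ≤
      ((∏ l ∈ Finset.Icc 1 (n₁ + n₂ - s.i), (s.partialRate μ₁ μ₂ l)⁻¹) *
        ∏ l ∈ Finset.Ico (n₁ + n₂ - s.i) (n₁ + n₂),
          (lam₁ + if l < n₁ + n₂ - s.K then lam₂ else 0)⁻¹) *
      ∏ j, max ((lam₁ + lam₂) / (n₁ * μ₁ + n₂ * μ₂)) (lam₂ / (n₁ * μ₁)) ^ s.q j := by
  have h1 : ∏ j, max ((lam₁ + lam₂) / (n₁ * μ₁ + n₂ * μ₂)) (lam₂ / (n₁ * μ₁)) ^ s.q j =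
      ∏ l ∈ Finset.Icc 1 (n₁ + n₂ - s.i),
        max ((lam₁ + lam₂) / (n₁ * μ₁ + n₂ * μ₂)) (lam₂ / (n₁ * μ₁)) ^ s.queue l := by
    rw [prod_Icc_one_eq_prod_fin]
    exact Finset.prod_congr rfl fun j _ => by rw [queue_succ]
  rw [totalWeight_eq, h1, mul_right_comm, ← Finset.prod_mul_distrib]
  refine mul_le_mul_of_nonneg_right (Finset.prod_le_prod (fun l hl => ?_) fun l hl => ?_)
    (Finset.prod_nonneg fun l _ => ?_)
  · obtain ⟨hl1, hl2⟩ := Finset.mem_Icc.1 hl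
    have := s.partialRate_pos hμ₁ hμ₂ hl1 (hl2.trans (Nat.sub_le _ _))
    have := s.waitRate_nonneg hlam₁ hlam₂ l
    positivity
  · obtain ⟨hl1, hl2⟩ := Finset.mem_Icc.1 hl
    have hl3 := hl2.trans (Nat.sub_le _ _)
    have h2 := s.partialRate_pos hμ₁ hμ₂ hl1 hl3
    have h3 := s.waitRate_nonneg hlam₁ hlam₂ l
    rw [pow_succ, ← div_div, ← div_pow, div_eq_mul_inv, mul_comm]
    refine mul_le_mul_of_nonneg_left ?_ (inv_nonneg.2 h2.le)
    exact pow_le_pow_left₀ (by positivity) (s.waitRate_div_le hn₁ hlam₂ hμ₁ hμ₂ hl3) _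
  · split_ifs <;> positivity

/-- Partial rates and `K` ignore the queue lengths, so the prefactor in `totalWeight_le` is constant
once the order and `i` are fixed. Only finitely many such pairs exist. -/
theorem exists_totalWeight_le (hn₁ : 0 < n₁) (hlam₁ : 0 < lam₁) (hlam₂ : 0 < lam₂) (hμ₁ : 0 < μ₁)
    (hμ₂ : 0 < μ₂) (e : Fin (n₁ + n₂) ≃ Server n₁ n₂) (i : ℕ) (hi : i ≤ n₁ + n₂) :
    ∃ C, ∀ q : Fin (n₁ + n₂ - i) → ℕ,
      (⟨e, i, hi, q⟩ : State n₁ n₂).totalWeight (arrivalRate lam₁ lam₂) (serviceRate μ₁ μ₂) ≤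
        C * ∏ j, max ((lam₁ + lam₂) / (n₁ * μ₁ + n₂ * μ₂)) (lam₂ / (n₁ * μ₁)) ^ q j := by
  have hP : ∀ q, (⟨e, i, hi, q⟩ : State n₁ n₂).partialRate μ₁ μ₂ =
    (⟨e, i, hi, 0⟩ : State n₁ n₂).partialRate μ₁ μ₂ := fun _ => rfl
  have hK : ∀ q, (⟨e, i, hi, q⟩ : State n₁ n₂).K = (⟨e, i, hi, 0⟩ : State n₁ n₂).K := fun _ => rfl
  refine ⟨(∏ l ∈ Finset.Icc 1 (n₁ + n₂ - i), ((⟨e, i, hi, 0⟩ : State n₁ n₂).partialRate μ₁ μ₂ l)⁻¹) *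
    ∏ l ∈ Finset.Ico (n₁ + n₂ - i) (n₁ + n₂),
      (lam₁ + if l < n₁ + n₂ - (⟨e, i, hi, 0⟩ : State n₁ n₂).K then lam₂ else 0)⁻¹,
    fun q => (totalWeight_le hn₁ hlam₁ hlam₂ hμ₁ hμ₂ ⟨e, i, hi, q⟩).trans_eq ?_⟩
  rw [hP q, hK q]

/-- A state as an order of the servers, a number of idle servers and queue lengths. -/
def sigmaEquiv (n₁ n₂ : ℕ) :
    (Σ a : (Fin (n₁ + n₂) ≃ Server n₁ n₂) × Fin (n₁ + n₂ + 1), Fin (n₁ + n₂ - a.2) → ℕ) ≃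
      State n₁ n₂ where
  toFun a := ⟨a.1.1, a.1.2, Nat.lt_succ_iff.1 a.1.2.isLt, a.2⟩
  invFun s := ⟨(s.perm, ⟨s.i, Nat.lt_succ_iff.2 s.i_le⟩), s.q⟩
  left_inv _ := rfl
  right_inv _ := rfl

theorem summable_totalWeight (hn₁ : 0 < n₁) (hlam₁ : 0 < lam₁) (hlam₂ : 0 < lam₂) (hμ₁ : 0 < μ₁)
    (hμ₂ : 0 < μ₂) (hρ : (lam₁ + lam₂) / (n₁ * μ₁ + n₂ * μ₂) < 1) (hδ : lam₂ / (n₁ * μ₁) < 1) :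
    Summable fun s : State n₁ n₂ =>
      s.totalWeight (arrivalRate lam₁ lam₂) (serviceRate μ₁ μ₂) := by
  rw [← (sigmaEquiv n₁ n₂).summable_iff]
  refine (summable_sigma_of_nonneg fun a => totalWeight_nonneg hlam₁ hlam₂ hμ₁ hμ₂ _).2
    ⟨fun a => ?_, (hasSum_fintype _).summable⟩
  obtain ⟨C, hC⟩ := exists_totalWeight_le hn₁ hlam₁ hlam₂ hμ₁ hμ₂ a.1 a.2
    (Nat.lt_succ_iff.1 a.2.isLt)
  exact Summable.of_nonneg_of_le (fun q => totalWeight_nonneg hlam₁ hlam₂ hμ₁ hμ₂ _) hC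
    ((summable_prod_geometric (le_max_of_le_right (by positivity)) (max_lt hρ hδ) _).mul_left C)

end State

/-- A configuration together with its state. -/
noncomputable def fiberEquiv (hn₁ : 0 < n₁) :
    (Σ s : State n₁ n₂, {x : Feasible n₁ n₂ // s.IsStateOf x.1}) ≃ Feasible n₁ n₂ :=
  Equiv.ofBijective (fun a => a.2.1) <| by
    constructor
    · rintro ⟨s, x, hs⟩ ⟨t, y, ht⟩ h
      obtain rfl : x = y := h
      obtain rfl := hs.unique ht
      rfl
    · intro x
      obtain ⟨s, hs⟩ := x.2.exists_state hn₁
      exact ⟨⟨s, x, hs⟩, rfl⟩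

theorem summable_weight (hn₁ : 0 < n₁) (hlam₁ : 0 < lam₁) (hlam₂ : 0 < lam₂) (hμ₁ : 0 < μ₁)
    (hμ₂ : 0 < μ₂) (hρ : (lam₁ + lam₂) / (n₁ * μ₁ + n₂ * μ₂) < 1) (hδ : lam₂ / (n₁ * μ₁) < 1) :
    Summable fun x : Feasible n₁ n₂ =>
      x.1.weight (arrivalRate lam₁ lam₂) (serviceRate μ₁ μ₂) := by
  rw [← (fiberEquiv hn₁).summable_iff]
  refine (summable_sigma_of_nonneg fun a => Config.weight_nonneg hlam₁ hlam₂ hμ₁ hμ₂ _).2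
    ⟨fun s => s.hasSum_weight.summable, ?_⟩
  exact (State.summable_totalWeight hn₁ hlam₁ hlam₂ hμ₁ hμ₂ hρ hδ).congr fun s =>
    s.hasSum_weight.tsum_eq.symm

theorem tsum_weight_pos (hlam₁ : 0 < lam₁) (hlam₂ : 0 < lam₂) (hμ₁ : 0 < μ₁) (hμ₂ : 0 < μ₂)
    (h : Summable fun x : Feasible n₁ n₂ =>
      x.1.weight (arrivalRate lam₁ lam₂) (serviceRate μ₁ μ₂)) :
    0 < ∑' x : Feasible n₁ n₂, x.1.weight (arrivalRate lam₁ lam₂) (serviceRate μ₁ μ₂) := by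
  obtain ⟨l, hl⟩ := exists_list_count_eq_one (n₁ := n₁) (n₂ := n₂)
  refine h.tsum_pos (fun x => x.1.weight_nonneg hlam₁ hlam₂ hμ₁ hμ₂)
    ⟨⟨[], l⟩, isFeasible_empty hl⟩ ?_
  exact mul_pos one_pos (idleWeight_pos (arrivalRate_pos hlam₁ hlam₂) l)

end NSystem

theorem mainTheorem7 (n₁ n₂ : ℕ) (hn₁ : 0 < n₁)
    (lam₁ lam₂ μ₁ μ₂ : ℝ) (hlam₁ : 0 < lam₁) (hlam₂ : 0 < lam₂) (hμ₁ : 0 < μ₁) (hμ₂ : 0 < μ₂)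
    (hρ : (lam₁ + lam₂) / (n₁ * μ₁ + n₂ * μ₂) < 1) (hδ : lam₂ / (n₁ * μ₁) < 1) :
    (∀ x : NSystem.Feasible n₁ n₂, ∃! s : NSystem.State n₁ n₂, s.IsStateOf x.1) ∧
    ∃ p : NSystem.Feasible n₁ n₂ → ℝ,
      NSystem.IsStationaryDistribution (NSystem.rate lam₁ lam₂ μ₁ μ₂) p ∧
      (∀ p' : NSystem.Feasible n₁ n₂ → ℝ,
        NSystem.IsStationaryDistribution (NSystem.rate lam₁ lam₂ μ₁ μ₂) p' → p' = p) ∧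
      ∃ B : ℝ, 0 < B ∧
        HasSum (fun s : NSystem.State n₁ n₂ => s.productForm lam₁ lam₂ μ₁ μ₂ B) 1 ∧
        ∀ s : NSystem.State n₁ n₂,
          HasSum (fun x : {x : NSystem.Feasible n₁ n₂ // s.IsStateOf x.1} => p x.1)
            (s.productForm lam₁ lam₂ μ₁ μ₂ B) := by
  have hsum := NSystem.summable_weight (n₂ := n₂) hn₁ hlam₁ hlam₂ hμ₁ hμ₂ hρ hδ
  have hpos := NSystem.tsum_weight_pos hlam₁ hlam₂ hμ₁ hμ₂ hsum
  set W : NSystem.Feasible n₁ n₂ → ℝ := fun x =>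
    x.1.weight (NSystem.arrivalRate lam₁ lam₂) (NSystem.serviceRate μ₁ μ₂) with hW
  -- The normalizing constant `B` will be `Z⁻¹`, the same for configurations and states because the
  -- configurations are partitioned by their states.
  set Z : ℝ := ∑' x, W x with hZ
  have hp1 : HasSum (fun x => Z⁻¹ * W x) 1 := by
    have := hsum.hasSum.mul_left Z⁻¹
    rwa [← hZ, inv_mul_cancel₀ hpos.ne'] at this
  have hfiber : ∀ s : NSystem.State n₁ n₂,
      HasSum (fun x : {x : NSystem.Feasible n₁ n₂ // s.IsStateOf x.1} => Z⁻¹ * W x.1)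
        (s.productForm lam₁ lam₂ μ₁ μ₂ Z⁻¹) := by
    intro s
    rw [← s.mul_totalWeight hn₁]
    exact s.hasSum_weight.mul_left _
  have hp : NSystem.IsStationaryDistribution (NSystem.rate lam₁ lam₂ μ₁ μ₂)
      fun x => Z⁻¹ * W x := by
    refine ⟨fun x => mul_nonneg (inv_nonneg.2 hpos.le)
      (x.1.weight_nonneg hlam₁ hlam₂ hμ₁ hμ₂), hp1, fun x => ?_⟩
    simpa only [mul_assoc] using
      (NSystem.hasSum_weight_mul_rate hn₁ hlam₁ hlam₂ hμ₁ hμ₂ x).mul_left Z⁻¹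
  refine ⟨fun x => ?_, fun x => Z⁻¹ * W x, hp,
    fun p' hp' => NSystem.stationary_unique hn₁ hlam₁ hlam₂ hμ₁ hμ₂ hp' hp,
    Z⁻¹, inv_pos.2 hpos, ?_, hfiber⟩
  · obtain ⟨s, hs⟩ := x.2.exists_state hn₁
    exact ⟨s, hs, fun t ht => ht.unique hs⟩
  · exact ((NSystem.fiberEquiv hn₁).hasSum_iff.2 hp1).sigma hfiber
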